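/- Let $s,t$ be real numbers with $0<t<2s$. For $k\ge 1$ let $$\mu_s^k(d\mathbf x)=(2\pi s)^{-k/2}e^{-\mathbf x^2/(2s)}\,d\mathbf x\ \text{ on }\mathbb R^k,\qquad \xi_{s,t}^k(d\mathbf u+i\,d\mathbf v)=(\pi(2s-t))^{-k/2}(\pi t)^{-k/2}e^{-\mathbf u^2/(2s-t)-\mathbf v^2/t}\,d\mathbf u\,d\mathbf v\ \text{ on }\mathbb C^k,$$ and let $\mu_s^\infty$ on $\mathbb R^\infty=\mathbb R^{\mathbb N}$ and $\xi_{s,t}^\infty$ on $\mathbb C^\infty=\mathbb C^{\mathbb N}$ be the infinite products of $\mu_s^1$ and $\xi_{s,t}^1$. A function of $k$ variables is regarded as a function of a sequence depending on its first $k$ entries; this embeds $L^2(\mathbb R^k,\mu_s^k)$ in $L^2(\mathbb R^\infty,\mu_s^\infty)$ and $L^2(\mathbb C^k,\xi_{s,t}^k)$ in $L^2(\mathbb C^\infty,\xi_{s,t}^\infty)$ isometrically (all $L^2$ spaces are complex). Let $\mathcal HL^2(\mathbb C^k,\xi_{s,t}^k)$ be the space of entire functions on $\mathbb C^k$ that are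 square integrable with respect to $\xi_{s,t}^k$, and let $\mathcal HL^2(\mathbb C^\infty,\xi_{s,t}^\infty)$ be the closure in $L^2(\mathbb C^\infty,\xi_{s,t}^\infty)$ of the set of holomorphic polynomials in finitely many of the variables $a_1,a_2,\dots$. For $f\in L^2(\mathbb R^k,\mu_s^k)$ put $$(\mathcal B_{s,t}^kf)(\mathbf z)=(2\pi t)^{-k/2}\int_{\mathbb R^k}f(\mathbf y)\,e^{-(\mathbf z-\mathbf y)^2/(2t)}\,d\mathbf y,\qquad \mathbf z\in\mathbb C^k,\quad \mathbf w^2:=\sum_{j=1}^k w_j^2,$$ and for $\lambda\in\mathbb R$ and $g$ entire on $\mathbb C^k$ put $(e^{\lambda(a\partial_a)_k}g)(\mathbf a)=g(e^\lambda\mathbf a)$. Then: 1. There is a unique unitary map $\mathcal B_{s,t}^\infty$ from $L^2(\mathbb R^\infty,\mu_s^\infty)$ onto $\mathcal HL^2(\mathbb C^\infty,\xi_{s,t}^\infty)$ such that $\mathcal B_{s,t}^\infty f=\mathcal B_{s,t}^kf$ for every $k\ge1$ and every $f\in L^2(\mathbb R^k,\mu_s^k)$. 2. For every $\lambda\in\mathbb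 R$ there is a unique unitary map $e^{\lambda(a\partial_a)_\infty}$ from $\mathcal HL^2(\mathbb C^\infty,\xi_{s,t}^\infty)$ onto $\mathcal HL^2(\mathbb C^\infty,\xi_{se^{-2\lambda},te^{-2\lambda}}^\infty)$ such that, for every $k\ge1$, every $g\in\mathcal HL^2(\mathbb C^k,\xi_{s,t}^k)$ belongs to $\mathcal HL^2(\mathbb C^\infty,\xi_{s,t}^\infty)$ and $e^{\lambda(a\partial_a)_\infty}g=e^{\lambda(a\partial_a)_k}g$. -/

import Mathlib

open MeasureTheory ProbabilityTheory
open scoped ENNReal NNReal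

noncomputable section

namespace SegalBargmann

/-! ### Cylinder functions on an infinite product -/

section Cylinder

variable {E : Type} [MeasurableSpace E] (ν : Measure E) [IsProbabilityMeasure ν]

/-- The first `k` coordinates of a sequence. -/
def firstCoords (k : ℕ) (x : ℕ → E) : Fin k → E := fun j => x j

theorem measurePreserving_firstCoords (k : ℕ) :
    MeasurePreserving (firstCoords k) (Measure.infinitePi fun _ : ℕ => ν)
      (Measure.pi fun _ : Fin k => ν) := by
  have hm : Measurable (firstCoords k : (ℕ → E) → Fin k → E) :=
    measurable_pi_iff.2 fun j => measurable_pi_apply _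
  refine ⟨hm, (Measure.pi_eq fun t ht => ?_).symm⟩
  rw [Measure.map_apply hm (MeasurableSet.univ_pi ht)]
  classical
  let u : ℕ → Set E := fun i => if h : i < k then t ⟨i, h⟩ else Set.univ
  have hpre : firstCoords k ⁻¹' Set.univ.pi t
      = ((Finset.range k : Finset ℕ) : Set ℕ).pi u := by
    ext x
    simp only [Set.mem_preimage, Set.mem_pi, Set.mem_univ, true_imp_iff, Finset.coe_range,
      Set.mem_Iio, firstCoords]
    constructor
    · intro h i hi
      simpa [u, hi] using h ⟨i, hi⟩
    · intro h i
      simpa [u, i.2] using h i i.2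
  have hu : ∀ i ∈ Finset.range k, MeasurableSet (u i) := by
    intro i hi
    have hi' : i < k := by simpa using hi
    simpa [u, hi'] using ht ⟨i, hi'⟩
  rw [hpre, Measure.infinitePi_pi _ hu, Finset.prod_range]
  refine Finset.prod_congr rfl fun i _ => ?_
  simp [u]

/-- The isometric inclusion of `L²` of the `k`-fold product into `L²` of the infinite product:
a function of `k` variables is regarded as a function of a sequence that depends only on its
first `k` coordinates. -/
def cylinder (k : ℕ) :
    Lp ℂ 2 (Measure.pi fun _ : Fin k => ν) →ₗᵢ[ℂ] Lp ℂ 2 (Measure.infinitePi fun _ : ℕ => ν) :=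
  Lp.compMeasurePreservingₗᵢ ℂ (firstCoords k) (measurePreserving_firstCoords ν k)

end Cylinder

/-! ### The Gaussian measures -/

/-- The Gaussian measure `(2πs)^{-1/2} exp(-x²/(2s)) dx` on `ℝ` (for `s > 0`). -/
def muOne (s : ℝ) : Measure ℝ := gaussianReal 0 s.toNNReal

instance isProbabilityMeasure_muOne (s : ℝ) : IsProbabilityMeasure (muOne s) := by
  unfold muOne; infer_instance

/-- The measure `(π(2s-t))^{-1/2} (πt)^{-1/2} exp(-u²/(2s-t) - v²/t) du dv` of `u + iv ∈ ℂ`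
(for `0 < t < 2s`): the real and imaginary parts are independent centred Gaussians of variance
`(2s-t)/2` and `t/2`. -/
def xiOne (s t : ℝ) : Measure ℂ :=
  ((gaussianReal 0 ((2 * s - t) / 2).toNNReal).prod (gaussianReal 0 (t / 2).toNNReal)).map
    Complex.measurableEquivRealProd.symm

instance isProbabilityMeasure_xiOne (s t : ℝ) : IsProbabilityMeasure (xiOne s t) :=
  Measure.isProbabilityMeasure_map Complex.measurableEquivRealProd.symm.measurable.aemeasurable

/-- `μ_s^k` on `ℝ^k`. -/
abbrev mu (k : ℕ) (s : ℝ) : Measure (Fin k → ℝ) := Measure.pi fun _ => muOne s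

/-- `μ_s^∞` on `ℝ^∞`. -/
abbrev muInf (s : ℝ) : Measure (ℕ → ℝ) := Measure.infinitePi fun _ => muOne s

/-- `ξ_{s,t}^k` on `ℂ^k`. -/
abbrev xi (k : ℕ) (s t : ℝ) : Measure (Fin k → ℂ) := Measure.pi fun _ => xiOne s t

/-- `ξ_{s,t}^∞` on `ℂ^∞`. -/
abbrev xiInf (s t : ℝ) : Measure (ℕ → ℂ) := Measure.infinitePi fun _ => xiOne s t

/-! ### Holomorphic `L²` spaces -/

/-- `HL²(ℂ^k, ξ_{s,t}^k)`: entire functions on `ℂ^k` that are square integrable. -/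
def HL2 (k : ℕ) (s t : ℝ) : Set ((Fin k → ℂ) → ℂ) :=
  {g | Differentiable ℂ g ∧ MemLp g 2 (xi k s t)}

/-- The holomorphic polynomials in finitely many of the variables `a₁, a₂, …`, as elements of
`L²(ℂ^∞, ξ_{s,t}^∞)`. -/
def holPoly (s t : ℝ) : Submodule ℂ (Lp ℂ 2 (xiInf s t)) where
  carrier := {F | ∃ p : MvPolynomial ℕ ℂ, F =ᵐ[xiInf s t] fun a => MvPolynomial.eval a p}
  zero_mem' := by
    refine ⟨0, ?_⟩
    filter_upwards [Lp.coeFn_zero ℂ 2 (xiInf s t)] with a h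
    rw [map_zero]
    exact h
  add_mem' := by
    rintro F G ⟨p, hp⟩ ⟨q, hq⟩
    refine ⟨p + q, ?_⟩
    filter_upwards [hp, hq, Lp.coeFn_add F G] with a h1 h2 h3
    rw [map_add, ← h1, ← h2]
    exact h3
  smul_mem' := by
    rintro c F ⟨p, hp⟩
    refine ⟨c • p, ?_⟩
    filter_upwards [hp, Lp.coeFn_smul c F] with a h1 h2
    rw [MvPolynomial.smul_eval, ← h1]
    exact h2

/-- `HL²(ℂ^∞, ξ_{s,t}^∞)`: the closure of the holomorphic polynomials in `L²(ℂ^∞, ξ_{s,t}^∞)`. -/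
def HL2Inf (s t : ℝ) : Submodule ℂ (Lp ℂ 2 (xiInf s t)) := (holPoly s t).topologicalClosure

/-! ### The transforms in finitely many variables -/

/-- The Segal–Bargmann transform
`(B_{s,t}^k f)(z) = (2πt)^{-k/2} ∫_{ℝ^k} f(y) exp(-(z-y)²/(2t)) dy`, where `w² = ∑ j, w_j²`;
the formula does not involve `s`, which only enters through the domain `L²(ℝ^k, μ_s^k)`. -/
def transform (k : ℕ) (t : ℝ) (f : (Fin k → ℝ) → ℂ) (z : Fin k → ℂ) : ℂ :=
  (((2 * Real.pi * t) ^ (-(k : ℝ) / 2) : ℝ) : ℂ) *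
    ∫ y : Fin k → ℝ, f y * Complex.exp (-(∑ j, (z j - (y j : ℂ)) ^ 2) / (2 * (t : ℂ)))

/-- The dilation `(e^{λ(a∂_a)_k} g)(a) = g(e^λ a)`. -/
def dilation (k : ℕ) (lam : ℂ) (g : (Fin k → ℂ) → ℂ) (a : Fin k → ℂ) : ℂ :=
  g (Complex.exp lam • a)

end SegalBargmann

end

/-! Everything rests on the exponentials `e_w(x) = exp(∑ w_j x_j)` of finitely supported `w`. They
are total in `L²(μ_s^∞)` by injectivity of the Fourier transform, and the Segal–Bargmann transform
multiplies `e_w` by `exp(t w²/2)`. One-variable Gaussian integrals give `⟨e_w, e_w'⟩ = exp(s(w̄ +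
w')²/2)` under `μ_s`, and the same times `exp(-t(w̄² + w'²)/2)` under `ξ_{s,t}`. The factors `exp(t
w²/2)` cancel the difference, so the Gram matrices agree and an isometry `V` exists
(`exists_isometry_exp`). Its range is the closed span of the exponentials, which is the closure of
the polynomials: Taylor series give one inclusion, difference quotients in `w` the other
(`range_eq_HL2Inf`). Since `t < 2s`, the value of the transform at a point is a bounded functional
on `L²(μ_s^k)`, which carries the integral formula from exponentials to all `f` (`ae_eq_transform`).

The dilation is composition with a measure preserving scaling that permutes the polynomials
(`exists_dilation`). The substantial point is that every square integrable entire function lies in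
the closure of the polynomials (`cylinder_mem_HL2Inf`). The mean value property yields a reproducing
formula `g(w) = A(w)⟨κ_w, g⟩`, and the kernels `κ_w` are multiples of transforms of Gaussians, hence
in the range of `V`. The projection of `g` to the closed span of the kernels has the same values as
`g`.

Uniqueness holds because cylinder functions, respectively polynomials, are dense. -/

noncomputable section

namespace SegalBargmann

open Filter Topology InnerProductSpace

/-! ### Hilbert space and `L²` tools -/

section Abstract

/-- Two families with the same Gram matrix, the first of which is total, are related by a linear
isometry. -/
theorem exists_linearIsometry_of_gram {ι H₁ H₂ : Type*}
    [NormedAddCommGroup H₁] [InnerProductSpace ℂ H₁]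
    [NormedAddCommGroup H₂] [InnerProductSpace ℂ H₂] [CompleteSpace H₂]
    (e : ι → H₁) (e' : ι → H₂) (hgram : ∀ i j, ⟪e i, e j⟫_ℂ = ⟪e' i, e' j⟫_ℂ)
    (hdense : (Submodule.span ℂ (Set.range e)).topologicalClosure = ⊤) :
    ∃ V : H₁ →ₗᵢ[ℂ] H₂, ∀ i, V (e i) = e' i := by
  let S := Finsupp.linearCombination ℂ e
  let T := Finsupp.linearCombination ℂ e'
  -- Equality of norms makes `S x ↦ T x` well defined and isometric on the span, even if the family
  -- `e` is linearly dependent.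
  have hST : ∀ x, ‖T x‖ = ‖S x‖ := by
    intro x
    have h : ⟪T x, T x⟫_ℂ = ⟪S x, S x⟫_ℂ := by
      simp only [S, T, Finsupp.linearCombination_apply, Finsupp.sum, sum_inner, inner_sum,
        inner_smul_left, inner_smul_right, hgram]
    rw [inner_self_eq_norm_sq_to_K, inner_self_eq_norm_sq_to_K] at h
    have h' : ‖T x‖ ^ 2 = ‖S x‖ ^ 2 := by exact_mod_cast h
    exact (sq_eq_sq₀ (norm_nonneg _) (norm_nonneg _)).1 h'
  have hd : DenseRange S := by
    rw [DenseRange, ← LinearMap.coe_range, Finsupp.range_linearCombination]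
    exact Submodule.dense_iff_topologicalClosure_eq_top.2 hdense
  have hn : ∀ x, ‖T x‖ ≤ 1 * ‖S x‖ := fun x => by rw [one_mul, hST]
  let W : H₁ →L[ℂ] H₂ := T.extendOfNorm S
  have hW : ∀ x, W (S x) = T x := LinearMap.extendOfNorm_eq hd ⟨1, hn⟩
  refine ⟨⟨W.toLinearMap, fun x => ?_⟩, fun i => ?_⟩
  · refine hd.induction_on (p := fun x => ‖W x‖ = ‖x‖) x
      (isClosed_eq (by fun_prop) (by fun_prop)) fun y => ?_
    rw [hW, hST]
  · have := hW (Finsupp.single i 1)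
    simpa [S, T] using this

variable {α : Type*} [MeasurableSpace α] {ν : Measure α}

/-- If a bounded operator into `L²` is given pointwise by bounded functionals on a set of vectors,
then so it is on the closed span of this set. -/
theorem ae_eq_of_mem_closure_span {H : Type*} [NormedAddCommGroup H] [NormedSpace ℂ H]
    (V : H →L[ℂ] Lp ℂ 2 ν) (ℓ : α → H →L[ℂ] ℂ) {A : Set H}
    (hA : ∀ x ∈ A, V x =ᵐ[ν] fun z => ℓ z x) {x : H}
    (hx : x ∈ (Submodule.span ℂ A).topologicalClosure) : V x =ᵐ[ν] fun z => ℓ z x := by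
  have hspan : ∀ y ∈ Submodule.span ℂ A, V y =ᵐ[ν] fun z => ℓ z y := by
    intro y hy
    induction hy using Submodule.span_induction with
    | mem y hy => exact hA y hy
    | zero =>
      simp only [map_zero]
      exact Lp.coeFn_zero ℂ 2 ν
    | add y z _ _ hy hz =>
      simp only [map_add]
      filter_upwards [hy, hz, Lp.coeFn_add (V y) (V z)] with a h1 h2 h3
      rw [h3, Pi.add_apply, h1, h2]
    | smul c y _ hy =>
      simp only [map_smul]
      filter_upwards [hy, Lp.coeFn_smul c (V y)] with a h1 h3
      rw [h3, Pi.smul_apply, h1]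
  obtain ⟨u, hu, hlim⟩ := mem_closure_iff_seq_limit.1 hx
  have h1 : Tendsto (fun n => V (u n)) atTop (𝓝 (V x)) := (V.continuous.tendsto x).comp hlim
  -- Convergence in `L²` is almost everywhere along a subsequence, and only countably many
  -- exceptional null sets occur.
  obtain ⟨ns, hns, h2⟩ := (tendstoInMeasure_of_tendsto_Lp h1).exists_seq_tendsto_ae
  have h3 : ∀ᵐ z ∂ν, ∀ n, V (u n) z = ℓ z (u n) := ae_all_iff.2 fun n => hspan _ (hu n)
  filter_upwards [h2, h3] with z h4 h5
  refine tendsto_nhds_unique h4 ?_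
  simp only [h5]
  exact (((ℓ z).continuous.tendsto x).comp hlim).comp hns.tendsto_atTop

/-- A closed subspace of `L²` is closed under dominated pointwise convergence. -/
theorem mem_of_dominated_convergence (K : Submodule ℂ (Lp ℂ 2 ν)) (hK : IsClosed (K : Set (Lp ℂ 2 ν)))
    {F : ℕ → α → ℂ} {f : α → ℂ} {G : α → ℝ} (hF : ∀ n, MemLp (F n) 2 ν) (hf : MemLp f 2 ν)
    (hG : MemLp G 2 ν) (hb : ∀ n z, ‖F n z‖ ≤ G z)
    (hlim : ∀ z, Tendsto (fun n => F n z) atTop (𝓝 (f z)))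
    (hmem : ∀ n, (hF n).toLp (F n) ∈ K) : hf.toLp f ∈ K := by
  -- As `K` is its own double orthogonal, weak convergence suffices: scalar dominated convergence
  -- applies to `⟪h, F n⟫` with majorant `‖h‖ G`.
  rw [← hK.submodule_topologicalClosure_eq,
    ← Submodule.orthogonal_orthogonal_eq_closure, Submodule.mem_orthogonal]
  intro h hh
  have key : ∀ {g : α → ℂ} (hg : MemLp g 2 ν), ⟪h, hg.toLp g⟫_ℂ = ∫ z, ⟪h z, g z⟫_ℂ ∂ν := by
    intro g hg
    rw [L2.inner_def]
    refine integral_congr_ae ?_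
    filter_upwards [hg.coeFn_toLp] with z hz
    rw [hz]
  rw [key]
  have h0 : ∀ n, ∫ z, ⟪h z, F n z⟫_ℂ ∂ν = 0 := fun n => by
    rw [← key (hF n)]
    exact (Submodule.mem_orthogonal' _ _).1 hh _ (hmem n)
  have ht : Tendsto (fun n => ∫ z, ⟪h z, F n z⟫_ℂ ∂ν) atTop (𝓝 (∫ z, ⟪h z, f z⟫_ℂ ∂ν)) := by
    refine tendsto_integral_of_dominated_convergence (fun z => ‖h z‖ * G z)
      (fun n => (Lp.aestronglyMeasurable h).inner (hF n).1) ((Lp.memLp h).norm.integrable_mul hG)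
      (fun n => Eventually.of_forall fun z => ?_) (Eventually.of_forall fun z => ?_)
    · exact (norm_inner_le_norm _ _).trans (mul_le_mul_of_nonneg_left (hb n z) (norm_nonneg _))
    · exact tendsto_const_nhds.inner (hlim z)
  simp only [h0] at ht
  exact tendsto_nhds_unique ht tendsto_const_nhds

/-- A function in `L²` of a finite measure whose integral over the sets of a generating π-system
vanishes is zero. -/
theorem Lp_eq_zero_of_setIntegral_eq_zero [IsFiniteMeasure ν] {C : Set (Set α)}
    (hgen : ‹MeasurableSpace α› = MeasurableSpace.generateFrom C) (hpi : IsPiSystem C)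
    (huniv : Set.univ ∈ C) (h : Lp ℂ 2 ν) (hz : ∀ A ∈ C, ∫ x in A, h x ∂ν = 0) : h = 0 := by
  have hint : Integrable h ν := (Lp.memLp h).integrable (by norm_num)
  have hall : ∀ A, MeasurableSet A → ∫ x in A, h x ∂ν = 0 := by
    intro A hA
    induction A, hA using MeasurableSpace.induction_on_inter hgen hpi with
    | empty => simp
    | basic A hA => exact hz A hA
    | compl A hA ih =>
      have := integral_add_compl hA hint
      rw [ih, zero_add] at this
      rw [this, ← setIntegral_univ, hz _ huniv]
    | iUnion f hd hm ih =>
      rw [integral_iUnion hm hd hint.integrableOn]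
      simp [ih]
  rw [Lp.eq_zero_iff_ae_eq_zero]
  exact hint.ae_eq_zero_of_forall_setIntegral_eq_zero fun A hA _ => hall A hA

end Abstract

/-! ### Gaussian densities and Gaussian exponentials -/

section Density

variable {E : Type*} [MeasurableSpace E] {m : Measure E}

theorem pi_withDensity_ofReal [SigmaFinite m] {k : ℕ} {ρ : E → ℝ} (h0 : ∀ x, 0 ≤ ρ x)
    (hi : Integrable ρ m) {ν : Measure E} [SigmaFinite ν]
    (hν : ν = m.withDensity fun x => ENNReal.ofReal (ρ x)) :
    (Measure.pi fun _ : Fin k => ν)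
      = (Measure.pi fun _ : Fin k => m).withDensity fun y => ENNReal.ofReal (∏ j, ρ (y j)) := by
  refine Measure.pi_eq fun S hS => ?_
  rw [withDensity_apply _ (MeasurableSet.univ_pi hS), Measure.restrict_pi_pi,
    ← ofReal_integral_eq_lintegral_ofReal (Integrable.fintype_prod fun j => hi.restrict)
      (Eventually.of_forall fun y => Finset.prod_nonneg fun j _ => h0 _),
    integral_fintype_prod_eq_prod (fun _ => ρ),
    ENNReal.ofReal_prod_of_nonneg fun j _ => integral_nonneg h0]
  refine Finset.prod_congr rfl fun j _ => ?_
  rw [hν, withDensity_apply _ (hS j), ofReal_integral_eq_lintegral_ofReal hi.restrict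
    (Eventually.of_forall h0)]

theorem integral_withDensity_ofReal {ρ : E → ℝ} (hρ : Measurable ρ) (h0 : ∀ x, 0 ≤ ρ x)
    (F : E → ℂ) :
    ∫ x, F x ∂(m.withDensity fun x => ENNReal.ofReal (ρ x)) = ∫ x, (ρ x : ℂ) * F x ∂m := by
  rw [integral_withDensity_eq_integral_toReal_smul hρ.ennreal_ofReal
    (Eventually.of_forall fun x => ENNReal.ofReal_lt_top)]
  simp only [ENNReal.toReal_ofReal (h0 _), Complex.real_smul]

theorem integrable_withDensity_ofReal_iff {ρ : E → ℝ} (hρ : Measurable ρ) (h0 : ∀ x, 0 ≤ ρ x)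
    (F : E → ℂ) :
    Integrable F (m.withDensity fun x => ENNReal.ofReal (ρ x))
      ↔ Integrable (fun x => (ρ x : ℂ) * F x) m := by
  rw [integrable_withDensity_iff_integrable_smul' hρ.ennreal_ofReal
    (Eventually.of_forall fun x => ENNReal.ofReal_lt_top)]
  simp only [ENNReal.toReal_ofReal (h0 _), Complex.real_smul]

end Density

section GaussianDensities

theorem gaussianReal_zero_eq_withDensity {v : ℝ} (hv : 0 < v) :
    gaussianReal 0 v.toNNReal = volume.withDensity fun x =>
      ENNReal.ofReal ((√(2 * Real.pi * v))⁻¹ * Real.exp (-x ^ 2 / (2 * v))) := by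
  have h : v.toNNReal ≠ 0 := by simpa using hv
  rw [gaussianReal_of_var_ne_zero _ h]
  congr 1
  ext x
  simp [gaussianPDF, gaussianPDFReal, hv.le]

theorem integrable_gaussian {v : ℝ} (hv : 0 < v) :
    Integrable fun x : ℝ => (√(2 * Real.pi * v))⁻¹ * Real.exp (-x ^ 2 / (2 * v)) := by
  have := (integrable_exp_neg_mul_sq (b := (2 * v)⁻¹) (by positivity)).const_mul
    (√(2 * Real.pi * v))⁻¹
  refine this.congr (Eventually.of_forall fun x => ?_)
  simp only
  congr 2
  field_simp

/-- The constant of the Gaussian density of `μ_s^1`. -/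
def muConst (s : ℝ) : ℝ := (√(2 * Real.pi * s))⁻¹

theorem mu_eq_withDensity (k : ℕ) {s : ℝ} (hs : 0 < s) :
    mu k s = volume.withDensity fun y =>
      ENNReal.ofReal (∏ j, (muConst s * Real.exp (-y j ^ 2 / (2 * s)))) :=
  pi_withDensity_ofReal (fun x => by positivity) (integrable_gaussian hs)
    (gaussianReal_zero_eq_withDensity hs)

/-- The density of `ξ_{s,t}^1`. -/
def xiDensity (s t : ℝ) (z : ℂ) : ℝ :=
  (muConst ((2 * s - t) / 2) * Real.exp (-z.re ^ 2 / (2 * ((2 * s - t) / 2)))) *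
    (muConst (t / 2) * Real.exp (-z.im ^ 2 / (2 * (t / 2))))

theorem measurable_xiDensity (s t : ℝ) : Measurable (xiDensity s t) := by
  unfold xiDensity; fun_prop

theorem xiDensity_nonneg (s t : ℝ) (z : ℂ) : 0 ≤ xiDensity s t z := by
  unfold xiDensity muConst; positivity

theorem integrable_xiDensity {s t : ℝ} (ht : 0 < t) (hts : t < 2 * s) :
    Integrable (xiDensity s t) := by
  have := (integrable_gaussian (v := (2 * s - t) / 2) (by linarith)).mul_prod
    (integrable_gaussian (v := t / 2) (by linarith))
  exact Complex.volume_preserving_equiv_real_prod.integrable_comp_of_integrable this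

theorem xiOne_eq_withDensity {s t : ℝ} (ht : 0 < t) (hts : t < 2 * s) :
    xiOne s t = volume.withDensity fun z => ENNReal.ofReal (xiDensity s t z) := by
  ext A hA
  rw [xiOne, gaussianReal_zero_eq_withDensity (v := (2 * s - t) / 2) (by linarith),
    gaussianReal_zero_eq_withDensity (v := t / 2) (by linarith),
    prod_withDensity (by fun_prop) (by fun_prop), MeasurableEquiv.map_apply,
    withDensity_apply _ hA, withDensity_apply _ (Complex.measurableEquivRealProd.symm.measurable hA),
    ← Complex.volume_preserving_equiv_real_prod.symm.setLIntegral_comp_preimage hA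
      (measurable_xiDensity s t).ennreal_ofReal]
  refine lintegral_congr fun x => ?_
  rw [← ENNReal.ofReal_mul (by positivity)]
  rfl

theorem xi_eq_withDensity (k : ℕ) {s t : ℝ} (ht : 0 < t) (hts : t < 2 * s) :
    xi k s t = volume.withDensity fun z => ENNReal.ofReal (∏ j, xiDensity s t (z j)) :=
  pi_withDensity_ofReal (xiDensity_nonneg s t)
    (integrable_xiDensity ht hts) (xiOne_eq_withDensity ht hts)

end GaussianDensities

section GaussianExponentials

/-- The Gaussian exponential `exp(∑ j, (w_j z_j + c z_j²))`. -/
def gaussExp {k : ℕ} (w : Fin k → ℂ) (c : ℂ) (z : Fin k → ℂ) : ℂ :=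
  Complex.exp (∑ j, (w j * z j + c * z j ^ 2))

theorem gaussExp_eq_prod {k : ℕ} (w : Fin k → ℂ) (c : ℂ) (z : Fin k → ℂ) :
    gaussExp w c z = ∏ j, Complex.exp (w j * z j + c * z j ^ 2) := Complex.exp_sum _ _

theorem continuous_gaussExp {k : ℕ} (w : Fin k → ℂ) (c : ℂ) : Continuous (gaussExp w c) := by
  unfold gaussExp; fun_prop

/-- The squared modulus times the density of `μ_s` has quadratic coefficient `2c - 1/(2s)`, which is
negative exactly when `4cs < 1`. -/
theorem memLp_gaussExp_mu {k : ℕ} {s c : ℝ} (hs : 0 < s) (hc : 4 * c * s < 1) (w : Fin k → ℂ) :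
    MemLp (fun y : Fin k → ℝ => gaussExp w c fun j => (y j : ℂ)) 2 (mu k s) := by
  have hcont : Continuous fun y : Fin k → ℝ => gaussExp w c fun j => (y j : ℂ) :=
    (continuous_gaussExp w c).comp (by fun_prop)
  rw [memLp_two_iff_integrable_sq_norm hcont.aestronglyMeasurable]
  have h1 : ∀ j, Integrable (fun x : ℝ => ‖Complex.exp (w j * x + c * (x : ℂ) ^ 2)‖ ^ 2)
      (muOne s) := by
    intro j
    have hb : (((2 * c - 1 / (2 * s) : ℝ) : ℂ)).re < 0 := by
      rw [Complex.ofReal_re, sub_neg, lt_div_iff₀ (by positivity)]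
      linarith
    have h2 := ((integrable_cexp_quadratic' hb ((2 * (w j).re : ℝ) : ℂ) 0).norm.const_mul
      (muConst s))
    rw [muOne, gaussianReal_zero_eq_withDensity hs, integrable_withDensity_iff_integrable_smul'
      (by fun_prop) (Eventually.of_forall fun x => ENNReal.ofReal_lt_top)]
    refine h2.congr (Eventually.of_forall fun x => ?_)
    simp only [smul_eq_mul]
    rw [ENNReal.toReal_ofReal (by positivity), Complex.norm_exp, Complex.norm_exp, ← Real.exp_nat_mul,
      muConst, mul_assoc _ (Real.exp _) (Real.exp _), ← Real.exp_add]
    congr 2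
    simp [sq]
    field_simp
    ring
  have h3 := Integrable.fintype_prod (μ := fun _ : Fin k => muOne s) h1
  refine h3.congr (Eventually.of_forall fun y => ?_)
  simp only
  rw [gaussExp_eq_prod, norm_prod, Finset.prod_pow]

end GaussianExponentials

/-! ### Density of cylinder functions -/

section CylinderDensity

variable {E : Type} [MeasurableSpace E] (ν : Measure E) [IsProbabilityMeasure ν]

theorem coeFn_cylinder (k : ℕ) (f : Lp ℂ 2 (Measure.pi fun _ : Fin k => ν)) :
    cylinder ν k f =ᵐ[Measure.infinitePi fun _ : ℕ => ν] fun x => f (firstCoords k x) :=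
  Lp.coeFn_compMeasurePreserving f (measurePreserving_firstCoords ν k)

/-- The square integrable functions of finitely many variables are dense. -/
theorem closure_span_cylinder :
    (Submodule.span ℂ {F | ∃ k : ℕ, 0 < k ∧ ∃ f, cylinder ν k f = F}).topologicalClosure = ⊤ := by
  rw [Submodule.topologicalClosure_eq_top_iff, Submodule.eq_bot_iff]
  intro h hh
  refine Lp_eq_zero_of_setIntegral_eq_zero (generateFrom_measurableCylinders).symm
    isPiSystem_measurableCylinders (univ_mem_measurableCylinders _) h fun A hA => ?_
  obtain ⟨I, S, hS, rfl⟩ := (mem_measurableCylinders A).1 hA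
  obtain ⟨k, hk⟩ : ∃ k : ℕ, ∀ i ∈ I, i < k := ⟨I.sup id + 1, fun i hi =>
    Nat.lt_succ_of_le (Finset.le_sup (f := id) hi)⟩
  -- A cylinder set over `I` is determined by the first `k + 1` coordinates; `k + 1` instead of `k`
  -- makes the number of variables visibly positive.
  let r : (Fin (k + 1) → E) → (I → E) := fun x i => x ⟨i, (hk i i.2).trans (Nat.lt_succ_self k)⟩
  have hr : Measurable r := measurable_pi_iff.2 fun i => measurable_pi_apply _
  have hS' : MeasurableSet (r ⁻¹' S) := hr hS
  have hA' : MeasurableSet (MeasureTheory.cylinder I S) :=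
    MeasurableSet.cylinder (α := fun _ : ℕ => E) I hS
  have hmem : indicatorConstLp 2 hA' (measure_ne_top (Measure.infinitePi fun _ : ℕ => ν) _) (1 : ℂ)
      ∈ Submodule.span ℂ {F | ∃ k : ℕ, 0 < k ∧ ∃ f, cylinder ν k f = F} := by
    refine Submodule.subset_span ⟨k + 1, Nat.succ_pos k,
      indicatorConstLp 2 hS' (measure_ne_top _ _) (1 : ℂ), ?_⟩
    exact Lp.indicatorConstLp_compMeasurePreserving hS' (measure_ne_top _ _) (1 : ℂ)
      (measurePreserving_firstCoords ν (k + 1))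
  rw [← L2.inner_indicatorConstLp_one (𝕜 := ℂ) hA' (measure_ne_top _ _) h]
  exact (Submodule.mem_orthogonal _ _).1 hh _ hmem

end CylinderDensity

/-! ### Fourier injectivity and totality of exponentials in finitely many variables -/

section FourierInjectivity

/-- A real function that is integrable with respect to a finite measure on `ℝ^k` is determined by
its Fourier transform. -/
theorem ae_eq_zero_of_fourier_eq_zero {k : ℕ} {μ : Measure (Fin k → ℝ)} [IsFiniteMeasure μ]
    {g : (Fin k → ℝ) → ℝ} (hm : Measurable g) (hg : Integrable g μ)
    (h : ∀ ω : Fin k → ℝ,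
      ∫ y, Complex.exp (∑ j, ω j * y j * Complex.I) * (g y : ℂ) ∂μ = 0) : g =ᵐ[μ] 0 := by
  -- The positive and negative parts of `g` are densities of finite measures, and these are
  -- determined by their characteristic functions.
  let P : Measure (Fin k → ℝ) := μ.withDensity fun y => ENNReal.ofReal (max (g y) 0)
  let N : Measure (Fin k → ℝ) := μ.withDensity fun y => ENNReal.ofReal (max (-g y) 0)
  have hPi : Integrable (fun y => max (g y) 0) μ := hg.pos_part
  have hNi : Integrable (fun y => max (-g y) 0) μ := hg.neg_part
  have hPm : Measurable fun y => max (g y) 0 := hm.max measurable_const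
  have hNm : Measurable fun y => max (-g y) 0 := hm.neg.max measurable_const
  have : IsFiniteMeasure P := isFiniteMeasure_withDensity_ofReal hPi.2
  have : IsFiniteMeasure N := isFiniteMeasure_withDensity_ofReal hNi.2
  have hPN : P = N := by
    refine Measure.ext_of_charFunDual (funext fun L => ?_)
    rw [charFunDual_apply, charFunDual_apply, integral_withDensity_ofReal hPm fun y => le_max_right _ _,
      integral_withDensity_ofReal hNm fun y => le_max_right _ _, ← sub_eq_zero]
    have hb : ∀ y, ‖Complex.exp (L y * Complex.I)‖ ≤ 1 := fun y => by
      rw [Complex.norm_exp_ofReal_mul_I]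
    have hmeas : AEStronglyMeasurable (fun y => Complex.exp (L y * Complex.I)) μ := by
      have : Continuous fun y => Complex.exp (L y * Complex.I) := by fun_prop
      exact this.aestronglyMeasurable
    have hP' : Integrable (fun y => ((max (g y) 0 : ℝ) : ℂ) * Complex.exp (L y * Complex.I)) μ :=
      hPi.ofReal.mul_bdd (c := 1) hmeas (Eventually.of_forall hb)
    have hN' : Integrable (fun y => ((max (-g y) 0 : ℝ) : ℂ) * Complex.exp (L y * Complex.I)) μ :=
      hNi.ofReal.mul_bdd (c := 1) hmeas (Eventually.of_forall hb)
    rw [← integral_sub hP' hN', ← h fun j => L (Pi.single j 1)]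
    refine integral_congr_ae (Eventually.of_forall fun y => ?_)
    have hL : L y = ∑ j, L (Pi.single j 1) * y j := by
      conv_lhs => rw [pi_eq_sum_univ' y, map_sum]
      refine Finset.sum_congr rfl fun j _ => ?_
      rw [map_smul, smul_eq_mul, mul_comm]
    have hpn : (g y : ℂ) = ((max (g y) 0 : ℝ) : ℂ) - ((max (-g y) 0 : ℝ) : ℂ) := by
      rw [← Complex.ofReal_sub, max_zero_sub_max_neg_zero_eq_self]
    simp only
    rw [hpn, hL, Complex.ofReal_sum, Finset.sum_mul]
    simp only [Complex.ofReal_mul]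
    ring
  have h2 := (withDensity_eq_iff (μ := μ) hPm.ennreal_ofReal.aemeasurable
    hNm.ennreal_ofReal.aemeasurable (measure_ne_top P Set.univ |> fun h => by
      rwa [withDensity_apply _ MeasurableSet.univ, setLIntegral_univ] at h)).1 hPN
  filter_upwards [h2] with y hy
  have := (ENNReal.ofReal_eq_ofReal_iff (le_max_right _ _) (le_max_right _ _)).1 hy
  rw [← max_zero_sub_max_neg_zero_eq_self (g y), this, sub_self]
  rfl

end FourierInjectivity

section ExpDensity

/-- The exponential `y ↦ exp(∑ j, w_j y_j)` in `L²(ℝ^k, μ_s^k)`. -/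
def expMu (k : ℕ) {s : ℝ} (hs : 0 < s) (w : Fin k → ℂ) : Lp ℂ 2 (mu k s) :=
  (memLp_gaussExp_mu (c := 0) hs (by simp) w).toLp _

theorem coeFn_expMu (k : ℕ) {s : ℝ} (hs : 0 < s) (w : Fin k → ℂ) :
    expMu k hs w =ᵐ[mu k s] fun y => gaussExp w 0 fun j => (y j : ℂ) := by
  refine (memLp_gaussExp_mu (c := 0) hs (by simp) w).coeFn_toLp.trans
    (Eventually.of_forall fun y => ?_)
  simp only [Complex.ofReal_zero]

/-- Imaginary exponents already suffice: a function orthogonal to them has vanishing Fourier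
transform against `μ_s^k`. -/
theorem closure_span_expMu (k : ℕ) {s : ℝ} (hs : 0 < s) :
    (Submodule.span ℂ (Set.range (expMu k hs))).topologicalClosure = ⊤ := by
  rw [Submodule.topologicalClosure_eq_top_iff, Submodule.eq_bot_iff]
  intro h hh
  have hint : Integrable h (mu k s) := (Lp.memLp h).integrable (by norm_num)
  have hmeas : Measurable h := (Lp.stronglyMeasurable h).measurable
  have h0 : ∀ ω : Fin k → ℝ,
      ∫ y, Complex.exp (∑ j, ω j * y j * Complex.I) * h y ∂(mu k s) = 0 := by
    intro ω
    have := (Submodule.mem_orthogonal _ _).1 hh _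
      (Submodule.subset_span ⟨fun j => -(ω j * Complex.I), rfl⟩)
    rw [← this, L2.inner_def]
    refine integral_congr_ae ?_
    filter_upwards [coeFn_expMu k hs fun j => -(ω j * Complex.I)] with y hy
    rw [hy, gaussExp, RCLike.inner_apply, ← Complex.exp_conj, map_sum, mul_comm]
    congr 2
    refine Finset.sum_congr rfl fun j _ => ?_
    simp
    ring
  -- Conjugating the identity at `-ω` handles the conjugate of `h`; sums and differences then
  -- isolate its real and imaginary parts, as Fourier injectivity is available for real functions.
  have h0' : ∀ ω : Fin k → ℝ, ∫ y, Complex.exp (∑ j, ω j * y j * Complex.I) *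
      (starRingEnd ℂ) (h y) ∂(mu k s) = 0 := by
    intro ω
    have := congrArg (starRingEnd ℂ) (h0 (-ω))
    rw [← integral_conj, map_zero] at this
    rw [← this]
    refine integral_congr_ae (Eventually.of_forall fun y => ?_)
    simp only [map_mul]
    rw [← Complex.exp_conj, map_sum]
    simp
  have hE : ∀ ω : Fin k → ℝ, ∀ {F : (Fin k → ℝ) → ℂ}, Integrable F (mu k s) →
      Integrable (fun y => Complex.exp (∑ j, ω j * y j * Complex.I) * F y) (mu k s) := by
    intro ω F hF
    refine hF.bdd_mul (c := 1) ?_ (Eventually.of_forall fun y => ?_)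
    · have : Continuous fun y : Fin k → ℝ => Complex.exp (∑ j, ω j * y j * Complex.I) := by fun_prop
      exact this.aestronglyMeasurable
    · have : (∑ j, (ω j : ℂ) * y j * Complex.I) = ((∑ j, ω j * y j : ℝ) : ℂ) * Complex.I := by
        push_cast
        rw [Finset.sum_mul]
      rw [this, Complex.norm_exp_ofReal_mul_I]
  have hint' : Integrable (fun y => (starRingEnd ℂ) (h y)) (mu k s) :=
    (LinearIsometryEquiv.integrable_comp_iff Complex.conjLIE).2 hint
  have hre : (fun y => (h y).re) =ᵐ[mu k s] 0 := by
    refine ae_eq_zero_of_fourier_eq_zero (Complex.measurable_re.comp hmeas) hint.re fun ω => ?_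
    have h1 := integral_add (hE ω hint) (hE ω hint')
    rw [h0, h0', add_zero] at h1
    have h2 : (2 : ℂ) * ∫ y, Complex.exp (∑ j, ω j * y j * Complex.I) * ((h y).re : ℂ) ∂(mu k s)
        = 0 := by
      rw [← h1, ← integral_const_mul]
      refine integral_congr_ae (Eventually.of_forall fun y => ?_)
      simp only
      rw [← mul_add, Complex.add_conj]
      push_cast
      ring
    simpa using h2
  have him : (fun y => (h y).im) =ᵐ[mu k s] 0 := by
    refine ae_eq_zero_of_fourier_eq_zero (Complex.measurable_im.comp hmeas) hint.im fun ω => ?_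
    have h1 := integral_sub (hE ω hint) (hE ω hint')
    rw [h0, h0', sub_zero] at h1
    have h2 : (2 * Complex.I) *
        ∫ y, Complex.exp (∑ j, ω j * y j * Complex.I) * ((h y).im : ℂ) ∂(mu k s) = 0 := by
      rw [← h1, ← integral_const_mul]
      refine integral_congr_ae (Eventually.of_forall fun y => ?_)
      simp only
      rw [← mul_sub, Complex.sub_conj]
      push_cast
      ring
    simpa using h2
  rw [Lp.eq_zero_iff_ae_eq_zero]
  filter_upwards [hre, him] with y h1 h2
  exact Complex.ext h1 h2

end ExpDensity

/-! ### The transform in finitely many variables -/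

section Transform

theorem muConst_pos {s : ℝ} (hs : 0 < s) : 0 < muConst s := by
  unfold muConst; positivity

/-- The Segal–Bargmann transform as an integral against the Gaussian measure. -/
theorem transform_eq_integral_mu (k : ℕ) {s t : ℝ} (hs : 0 < s) (f : (Fin k → ℝ) → ℂ)
    (z : Fin k → ℂ) :
    transform k t f z = (((2 * Real.pi * t) ^ (-(k : ℝ) / 2) : ℝ) : ℂ) *
      ((muConst s : ℂ) ^ k)⁻¹ * Complex.exp (-(∑ j, z j ^ 2) / (2 * t)) *
      ∫ y, f y * gaussExp (fun j => z j / t) (1 / (2 * s) - 1 / (2 * t)) (fun j => (y j : ℂ))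
        ∂(mu k s) := by
  rw [mu_eq_withDensity k hs, integral_withDensity_ofReal (by fun_prop)
    (fun y => Finset.prod_nonneg fun j _ => by have := muConst_pos hs; positivity), transform,
    (by intros; ring : ∀ a b c d : ℂ, a * b * c * d = a * (b * (c * d)))]
  congr 1
  rw [← integral_const_mul, ← integral_const_mul]
  refine integral_congr_ae (Eventually.of_forall fun y => ?_)
  simp only
  have hc : (muConst s : ℂ) ≠ 0 := by exact_mod_cast (muConst_pos hs).ne'
  rw [Finset.prod_mul_distrib, Finset.prod_const, Finset.card_fin, ← Real.exp_sum, gaussExp]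
  push_cast
  -- Splitting off the density of `μ_s` leaves the quadratic coefficient `1/(2s) - 1/(2t)` in `y`.
  have : Complex.exp (-(∑ j, (z j - (y j : ℂ)) ^ 2) / (2 * t))
      = Complex.exp (-(∑ j, z j ^ 2) / (2 * t)) * (Complex.exp (∑ j, -(y j : ℂ) ^ 2 / (2 * s)) *
        Complex.exp (∑ j, (z j / t * y j + (1 / (2 * s) - 1 / (2 * t)) * (y j : ℂ) ^ 2))) := by
    rw [← Complex.exp_add, ← Complex.exp_add, neg_div, neg_div, Finset.sum_div, Finset.sum_div,
      ← Finset.sum_neg_distrib, ← Finset.sum_neg_distrib, ← Finset.sum_add_distrib,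
      ← Finset.sum_add_distrib]
    congr 1
    refine Finset.sum_congr rfl fun j _ => ?_
    ring
  rw [this]
  generalize Complex.exp (∑ j, -(y j : ℂ) ^ 2 / (2 * s)) = B
  generalize Complex.exp (-(∑ j, z j ^ 2) / (2 * t)) = A
  generalize Complex.exp (∑ j, (z j / t * y j + (1 / (2 * s) - 1 / (2 * t)) * (y j : ℂ) ^ 2)) = G
  field_simp

theorem transform_congr_ae (k : ℕ) {s t : ℝ} (hs : 0 < s) {f g : (Fin k → ℝ) → ℂ}
    (h : f =ᵐ[mu k s] g) : transform k t f = transform k t g := by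
  ext z
  rw [transform_eq_integral_mu k hs, transform_eq_integral_mu k hs]
  congr 1
  refine integral_congr_ae ?_
  filter_upwards [h] with y hy
  rw [hy]

/-- The value of the transform at a point is a bounded functional on `L²(ℝ^k, μ_s^k)`. -/
theorem exists_transform_functional (k : ℕ) {s t : ℝ} (ht : 0 < t) (hts : t < 2 * s) :
    ∃ ℓ : (Fin k → ℂ) → Lp ℂ 2 (mu k s) →L[ℂ] ℂ, ∀ z (f : Lp ℂ 2 (mu k s)), transform k t f z = ℓ z f := by
  have hs : 0 < s := by linarith
  -- The left side is `2 - 2s/t`, so square integrability of the kernel in `y` is precisely the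
  -- condition `t < 2s`.
  have hc : 4 * (1 / (2 * s) - 1 / (2 * t)) * s < 1 := by
    have : s / t > 1 / 2 := by rw [gt_iff_lt, lt_div_iff₀ ht]; linarith
    have e : 4 * (1 / (2 * s) - 1 / (2 * t)) * s = 2 - 2 * (s / t) := by field_simp; ring
    rw [e]; linarith
  let κ : (Fin k → ℂ) → Lp ℂ 2 (mu k s) := fun z =>
    (memLp_gaussExp_mu hs hc fun j => (starRingEnd ℂ) (z j / t)).toLp _
  refine ⟨fun z => ((((2 * Real.pi * t) ^ (-(k : ℝ) / 2) : ℝ) : ℂ) *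
      ((muConst s : ℂ) ^ k)⁻¹ * Complex.exp (-(∑ j, z j ^ 2) / (2 * t))) • innerSL ℂ (κ z),
    fun z f => ?_⟩
  rw [transform_eq_integral_mu k hs, smul_apply, innerSL_apply_apply, smul_eq_mul,
    L2.inner_def]
  congr 1
  refine integral_congr_ae ?_
  filter_upwards [(memLp_gaussExp_mu hs hc fun j => (starRingEnd ℂ) (z j / t)).coeFn_toLp] with y hy
  rw [RCLike.inner_apply, hy, gaussExp, gaussExp, ← Complex.exp_conj, map_sum]
  congr 2
  refine Finset.sum_congr rfl fun j _ => ?_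
  simp [map_ofNat]

/-- Completing the square; the integral converges because `c - 1/(2t)` is negative. -/
theorem integral_gaussExp_one {t c : ℝ} (ht : 0 < t) (hc : 2 * c * t < 1) (w z : ℂ) :
    ((muConst t : ℝ) : ℂ) * ∫ y : ℝ, Complex.exp (w * y + c * (y : ℂ) ^ 2 - (z - y) ^ 2 / (2 * t))
      = (((√(1 - 2 * c * t))⁻¹ : ℝ) : ℂ) *
        Complex.exp ((t * w ^ 2 / 2 + w * z + c * z ^ 2) / (1 - 2 * c * t)) := by
  have hq : 0 < 1 - 2 * c * t := by linarith
  have hqc : (1 - 2 * c * t : ℂ) ≠ 0 := by exact_mod_cast hq.ne'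
  have htc : (t : ℂ) ≠ 0 := by exact_mod_cast ht.ne'
  have hbr : c - 1 / (2 * t) = -((1 - 2 * c * t) / (2 * t)) := by field_simp; ring
  have hb : (((c - 1 / (2 * t) : ℝ) : ℂ)).re < 0 := by
    rw [Complex.ofReal_re, hbr]
    exact neg_neg_of_pos (by positivity)
  have h := integral_cexp_quadratic hb (w + z / t) (-(z ^ 2 / (2 * t)))
  have e1 : (fun y : ℝ => Complex.exp (w * y + c * (y : ℂ) ^ 2 - (z - y) ^ 2 / (2 * t)))
      = fun y : ℝ => Complex.exp (((c - 1 / (2 * t) : ℝ) : ℂ) * (y : ℂ) ^ 2 + (w + z / t) * y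
        + -(z ^ 2 / (2 * t))) := by
    ext y
    congr 1
    push_cast
    field_simp
    ring
  rw [e1, h, ← mul_assoc]
  congr 1
  · rw [hbr]
    have : (Real.pi : ℂ) / -((-((1 - 2 * c * t) / (2 * t)) : ℝ) : ℂ)
        = ((2 * Real.pi * t / (1 - 2 * c * t) : ℝ) : ℂ) := by
      push_cast
      field_simp
    rw [this, show (1 / 2 : ℂ) = ((1 / 2 : ℝ) : ℂ) by push_cast; rfl,
      ← Complex.ofReal_cpow (by positivity), ← Real.sqrt_eq_rpow, ← Complex.ofReal_mul, muConst,
      Real.sqrt_div (by positivity)]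
    congr 1
    have : √(2 * Real.pi * t) ≠ 0 := by positivity
    field_simp
  · congr 1
    rw [hbr]
    push_cast
    rw [mul_neg, div_neg, sub_neg_eq_add]
    -- Expressing `c` through `q` turns the comparison of exponents into an identity of rational
    -- functions with monomial denominators.
    set q : ℂ := 1 - 2 * c * t with hq'
    have hcq : (c : ℂ) = (1 - q) / (2 * t) := by
      rw [hq']
      field_simp
      ring
    rw [hcq]
    field_simp
    ring

/-- The transform of a Gaussian exponential is a Gaussian exponential. -/
theorem transform_gaussExp (k : ℕ) {t c : ℝ} (ht : 0 < t) (hc : 2 * c * t < 1) (w z : Fin k → ℂ) :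
    transform k t (fun y => gaussExp w c fun j => (y j : ℂ)) z
      = (((√(1 - 2 * c * t))⁻¹ ^ k : ℝ) : ℂ) *
        Complex.exp (∑ j, t * w j ^ 2 / 2 / (1 - 2 * c * t)) *
        gaussExp (fun j => w j / (1 - 2 * c * t)) (c / (1 - 2 * c * t)) z := by
  have hconst : ((2 * Real.pi * t) ^ (-(k : ℝ) / 2) : ℝ) = muConst t ^ k := by
    rw [muConst, Real.sqrt_eq_rpow, ← Real.rpow_neg (by positivity), ← Real.rpow_natCast,
      ← Real.rpow_mul (by positivity)]
    congr 1
    ring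
  have hint : ∀ y : Fin k → ℝ, gaussExp w c (fun j => (y j : ℂ)) *
      Complex.exp (-(∑ j, (z j - (y j : ℂ)) ^ 2) / (2 * (t : ℂ)))
      = ∏ j, Complex.exp (w j * y j + c * (y j : ℂ) ^ 2 - (z j - y j) ^ 2 / (2 * t)) := by
    intro y
    rw [← Complex.exp_sum, gaussExp, ← Complex.exp_add, Finset.sum_sub_distrib, neg_div,
      Finset.sum_div, sub_eq_add_neg]
  rw [transform, hconst]
  simp only [hint]
  rw [integral_fintype_prod_volume_eq_prod (fun j (y : ℝ) =>
    Complex.exp (w j * y + c * (y : ℂ) ^ 2 - (z j - y) ^ 2 / (2 * t))), Complex.ofReal_pow,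
    ← Fin.prod_const, ← Finset.prod_mul_distrib]
  simp only [integral_gaussExp_one ht hc]
  rw [Finset.prod_mul_distrib, Finset.prod_const, Finset.card_fin, Complex.ofReal_pow,
    mul_assoc (_ ^ k), ← Complex.exp_sum, gaussExp, ← Complex.exp_add, ← Finset.sum_add_distrib]
  congr 2
  refine Finset.sum_congr rfl fun j _ => ?_
  ring

end Transform

/-! ### Mean value property and reproducing kernels -/

section MeanValue

theorem measurePreserving_rotation (k : ℕ) (θ : ℝ) :
    MeasurePreserving fun z : Fin k → ℂ => Complex.exp (θ * Complex.I) • z := by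
  have := volume_preserving_pi fun _ : Fin k => (rotation (Circle.exp θ)).measurePreserving
  have e : (fun z : Fin k → ℂ => Complex.exp (θ * Complex.I) • z)
      = fun z i => rotation (Circle.exp θ) (z i) := by
    ext z i
    simp [rotation_apply]
  rw [e]
  exact this

/-- The mean value property in `ℂ^k` with respect to a weight invariant under rotations. -/
theorem integral_mul_of_rotation_invariant {k : ℕ} {H : (Fin k → ℂ) → ℂ} (hH : Differentiable ℂ H)
    {γ : (Fin k → ℂ) → ℝ} (hγ : Continuous γ)
    (hrot : ∀ (θ : ℝ) z, γ (Complex.exp (θ * Complex.I) • z) = γ z)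
    (hint : Integrable fun z => (γ z : ℂ) * H z) :
    ∫ z, (γ z : ℂ) * H z = H 0 * ∫ z, (γ z : ℂ) := by
  have hrotint : ∀ θ : ℝ, Integrable fun z => (γ z : ℂ) * H (Complex.exp (θ * Complex.I) • z) := by
    intro θ
    refine ((measurePreserving_rotation k θ).integrable_comp_of_integrable hint).congr
      (Eventually.of_forall fun z => ?_)
    simp [hrot]
  have hemb : ∀ θ : ℝ,
      MeasurableEmbedding fun z : Fin k → ℂ => Complex.exp (θ * Complex.I) • z := fun θ =>
    (Homeomorph.smulOfNeZero (Complex.exp (θ * Complex.I)) (Complex.exp_ne_zero _)).measurableEmbedding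
  have h1 : ∀ θ : ℝ, ∫ z, (γ z : ℂ) * H (Complex.exp (θ * Complex.I) • z) = ∫ z, (γ z : ℂ) * H z := by
    intro θ
    have := (measurePreserving_rotation k θ).integral_comp (hemb θ) fun z => (γ z : ℂ) * H z
    simpa only [hrot] using this
  have h1n : ∀ θ : ℝ, ∫ z, ‖(γ z : ℂ) * H (Complex.exp (θ * Complex.I) • z)‖
      = ∫ z, ‖(γ z : ℂ) * H z‖ := by
    intro θ
    have := (measurePreserving_rotation k θ).integral_comp (hemb θ) fun z => ‖(γ z : ℂ) * H z‖
    simpa only [hrot] using this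
  -- For fixed `z`, the function `ζ ↦ H (ζ • z)` is entire in one variable, so its mean over the
  -- unit circle is `H 0`.
  have h2 : ∀ z, ∫ θ in (0 : ℝ)..2 * Real.pi, H (Complex.exp (θ * Complex.I) • z)
      = (2 * Real.pi : ℂ) * H 0 := by
    intro z
    have hd : Differentiable ℂ fun ζ : ℂ => H (ζ • z) := hH.comp (by fun_prop)
    have := (hd.diffContOnCl (s := Metric.ball 0 |(1 : ℝ)|)).circleAverage
    rw [Real.circleAverage_def] at this
    simp only [circleMap, zero_add, Complex.ofReal_one, one_mul, zero_smul, Complex.real_smul]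
      at this
    rw [← this, ← mul_assoc]
    push_cast
    rw [mul_inv_cancel₀ (by exact_mod_cast Real.two_pi_pos.ne'), one_mul]
  have hcont : Continuous fun p : ℝ × (Fin k → ℂ) =>
      (γ p.2 : ℂ) * H (Complex.exp (p.1 * Complex.I) • p.2) := by
    have := hH.continuous
    fun_prop
  -- Fubini applies since the `L¹` norm of the rotated integrand does not depend on `θ`.
  have hswap := integral_integral_swap (μ := volume.restrict (Set.Ioc 0 (2 * Real.pi)))
    (ν := (volume : Measure (Fin k → ℂ)))
    (f := fun θ z => (γ z : ℂ) * H (Complex.exp (θ * Complex.I) • z)) (by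
      refine (integrable_prod_iff hcont.aestronglyMeasurable).2 ?_
      refine ⟨Eventually.of_forall hrotint, ?_⟩
      simp only [h1n]
      exact integrable_const _)
  have hinner : ∀ z, ∫ θ in Set.Ioc 0 (2 * Real.pi), (γ z : ℂ) * H (Complex.exp (θ * Complex.I) • z)
      = (2 * Real.pi : ℂ) * (H 0 * γ z) := by
    intro z
    rw [integral_const_mul, ← intervalIntegral.integral_of_le Real.two_pi_pos.le, h2]
    ring
  simp only [h1, hinner] at hswap
  rw [integral_const_mul, integral_const_mul, setIntegral_const] at hswap
  have hpi : (2 * Real.pi : ℂ) ≠ 0 := by exact_mod_cast Real.two_pi_pos.ne'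
  refine mul_left_cancel₀ hpi ?_
  rw [← hswap]
  simp [Real.two_pi_pos.le]

/-- The reproducing property of the exponentials in the Fock space. -/
theorem fock_reproducing {k : ℕ} {G : (Fin k → ℂ) → ℂ} (hG : Differentiable ℂ G) (b : ℝ)
    (w : Fin k → ℂ)
    (hint : Integrable fun z => Complex.exp (∑ j, (b * (w j * (starRingEnd ℂ) (z j))
      - b * (z j * (starRingEnd ℂ) (z j)))) * G z) :
    ∫ z, Complex.exp (∑ j, (b * (w j * (starRingEnd ℂ) (z j))
      - b * (z j * (starRingEnd ℂ) (z j)))) * G z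
      = G w * ∫ z : Fin k → ℂ, ((Real.exp (-(b * ∑ j, ‖z j‖ ^ 2)) : ℝ) : ℂ) := by
  have hshift : ∀ z : Fin k → ℂ, Complex.exp (∑ j, (b * (w j * (starRingEnd ℂ) ((z + w) j))
      - b * ((z + w) j * (starRingEnd ℂ) ((z + w) j)))) * G (z + w)
      = ((Real.exp (-(b * ∑ j, ‖z j‖ ^ 2)) : ℝ) : ℂ) *
        (Complex.exp (∑ j, -(b * (z j * (starRingEnd ℂ) (w j)))) * G (z + w)) := by
    intro z
    rw [← mul_assoc, Complex.ofReal_exp, ← Complex.exp_add]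
    congr 2
    push_cast
    rw [Finset.mul_sum, ← Finset.sum_neg_distrib, ← Finset.sum_add_distrib]
    refine Finset.sum_congr rfl fun j _ => ?_
    rw [← Complex.mul_conj', Pi.add_apply, map_add]
    ring
  have hint' := hint.comp_add_right w
  rw [← integral_add_right_eq_self _ w]
  simp only [hshift] at hint' ⊢
  rw [integral_mul_of_rotation_invariant (by fun_prop) (by fun_prop) (fun θ z => ?_) hint']
  · simp
  · simp [Complex.norm_exp_ofReal_mul_I]

end MeanValue

section Reproducing

variable {s t : ℝ}

/-- The Gaussian exponentials that reproduce the elements of `HL²(ℂ^k, ξ_{s,t}^k)`. -/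
def xiKernel (k : ℕ) (s t : ℝ) (w : Fin k → ℂ) : (Fin k → ℂ) → ℂ :=
  gaussExp (fun j => ((1 / (2 * s - t) + 1 / t) / 2 : ℝ) * (starRingEnd ℂ) (w j))
    (((1 / (2 * s - t) - 1 / t) / 4 : ℝ) : ℂ)

theorem differentiable_gaussExp {k : ℕ} (w : Fin k → ℂ) (c : ℂ) :
    Differentiable ℂ (gaussExp w c) := by
  unfold gaussExp; fun_prop

/-- The value of an element of `HL²(ℂ^k, ξ_{s,t}^k)` at a point is an inner product. -/
theorem exists_reproducing (k : ℕ) (ht : 0 < t) (hts : t < 2 * s)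
    (hmem : ∀ w, MemLp (xiKernel k s t w) 2 (xi k s t)) :
    ∃ A : (Fin k → ℂ) → ℂ, ∀ g ∈ HL2 k s t, ∀ w,
      g w = A w * ∫ z, (starRingEnd ℂ) (xiKernel k s t w z) * g z ∂(xi k s t) := by
  set b : ℝ := (1 / (2 * s - t) + 1 / t) / 2 with hb
  set c : ℝ := (1 / (2 * s - t) - 1 / t) / 4 with hc
  have h2 : 0 < 2 * s - t := by linarith
  have hbpos : 0 < b := by positivity
  let M : ℝ := (muConst ((2 * s - t) / 2) * muConst (t / 2)) ^ k
  have hM : (M : ℂ) ≠ 0 := by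
    have h3 := muConst_pos (s := (2 * s - t) / 2) (by linarith)
    have h4 := muConst_pos (s := t / 2) (by linarith)
    exact_mod_cast (by positivity : M ≠ 0)
  let J : ℂ := ∫ z : Fin k → ℂ, ((Real.exp (-(b * ∑ j, ‖z j‖ ^ 2)) : ℝ) : ℂ)
  have hJ : J ≠ 0 := by
    have e : ∀ z : Fin k → ℂ, Real.exp (-(b * ∑ j, ‖z j‖ ^ 2)) = ∏ j, Real.exp (-b * ‖z j‖ ^ 2) := by
      intro z
      rw [← Real.exp_sum, Finset.mul_sum, ← Finset.sum_neg_distrib]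
      simp only [neg_mul]
    simp only [J, e]
    rw [integral_complex_ofReal, integral_fintype_prod_volume_eq_prod
      (fun _ (z : ℂ) => Real.exp (-b * ‖z‖ ^ 2))]
    simp only [GaussianFourier.integral_rexp_neg_mul_sq_norm hbpos]
    have : 0 < Real.pi / b := div_pos Real.pi_pos hbpos
    exact_mod_cast (Finset.prod_pos fun j _ => Real.rpow_pos_of_pos this _).ne'
  -- With `u = (z + z̄)/2` and `v² = -((z - z̄)/2)²`, the density has exponent `-b z z̄ - c(z² +
  -- z̄²)`. The conjugate kernel cancels `-c z̄²`, and `exp(-c z²)` is joined to the entire function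
  -- `g`, which leads to the Fock weight.
  have key : ∀ (g : (Fin k → ℂ) → ℂ) (w z : Fin k → ℂ),
      ((∏ j, xiDensity s t (z j) : ℝ) : ℂ) * ((starRingEnd ℂ) (xiKernel k s t w z) * g z)
      = M * (Complex.exp (∑ j, (b * (w j * (starRingEnd ℂ) (z j))
          - b * (z j * (starRingEnd ℂ) (z j)))) * (gaussExp 0 (-c) z * g z)) := by
    intro g w z
    have e1 : ∏ j, xiDensity s t (z j) = M * Real.exp (∑ j,
        (-(z j).re ^ 2 / (2 * ((2 * s - t) / 2)) + -(z j).im ^ 2 / (2 * (t / 2)))) := by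
      simp only [M]
      rw [Real.exp_sum, ← Fin.prod_const, ← Finset.prod_mul_distrib]
      refine Finset.prod_congr rfl fun j _ => ?_
      rw [xiDensity, Real.exp_add]
      ring
    rw [e1, Complex.ofReal_mul, Complex.ofReal_exp, xiKernel, gaussExp, gaussExp, ← Complex.exp_conj,
      mul_assoc, ← mul_assoc (Complex.exp _) (Complex.exp _) (g z), ← Complex.exp_add,
      ← mul_assoc (Complex.exp _) (Complex.exp _) (g z), ← Complex.exp_add, map_sum]
    congr 3
    simp only [map_add, map_mul, map_pow, Complex.conj_conj, Complex.conj_ofReal]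
    push_cast
    rw [← Finset.sum_add_distrib, ← Finset.sum_add_distrib]
    refine Finset.sum_congr rfl fun j _ => ?_
    have hre : ((z j).re : ℂ) = (z j + (starRingEnd ℂ) (z j)) / 2 := by
      rw [Complex.add_conj]; push_cast; ring
    have him : ((z j).im : ℂ) ^ 2 = -((z j - (starRingEnd ℂ) (z j)) / 2) ^ 2 := by
      rw [Complex.sub_conj]
      push_cast
      linear_combination (((z j).im : ℂ) ^ 2) * Complex.I_sq
    rw [hre, him]
    rw [Pi.zero_apply, hb, hc]
    push_cast
    ring
  refine ⟨fun w => (M * J * gaussExp 0 (-c) w)⁻¹, fun g hg w => ?_⟩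
  have hG : Differentiable ℂ fun z => gaussExp 0 (-c) z * g z :=
    (differentiable_gaussExp _ _).mul hg.1
  have hi : Integrable (fun z => (starRingEnd ℂ) (xiKernel k s t w z) * g z) (xi k s t) :=
    (hmem w).star.integrable_mul hg.2
  have hρ : Measurable fun z : Fin k → ℂ => ∏ j, xiDensity s t (z j) :=
    Finset.measurable_fun_prod _ fun j _ => (measurable_xiDensity s t).comp (measurable_pi_apply j)
  have h0 : ∀ z : Fin k → ℂ, 0 ≤ ∏ j, xiDensity s t (z j) := fun z =>
    Finset.prod_nonneg fun j _ => xiDensity_nonneg s t _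
  rw [xi_eq_withDensity k ht hts, integrable_withDensity_ofReal_iff
    hρ h0] at hi
  simp only [key] at hi
  have hi' : Integrable fun z => Complex.exp (∑ j, (b * (w j * (starRingEnd ℂ) (z j))
      - b * (z j * (starRingEnd ℂ) (z j)))) * (gaussExp 0 (-c) z * g z) :=
    (integrable_const_mul_iff (IsUnit.mk0 _ hM) _).1 hi
  rw [xi_eq_withDensity k ht hts, integral_withDensity_ofReal
    hρ h0]
  simp only [key]
  rw [integral_const_mul, fock_reproducing hG b w hi']
  have hw : gaussExp 0 (-c) w ≠ 0 := Complex.exp_ne_zero _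
  change g w = (M * J * gaussExp 0 (-c) w)⁻¹ * (M * (gaussExp 0 (-c) w * g w * J))
  field_simp

end Reproducing

/-! ### Functions of exponential growth and their integrability -/

section Growth

variable {E : Type} [NormedAddCommGroup E]

/-- The bound `exp(N(1 + ∑_{j<N} ‖x_j‖))`. -/
def growth (N : ℕ) (x : ℕ → E) : ℝ := Real.exp (N * (1 + ∑ j ∈ Finset.range N, ‖x j‖))

/-- A single index bounds both the rate and the number of coordinates, so indices simply add under
products. -/
theorem growth_mul_le (M N : ℕ) (x : ℕ → E) : growth M x * growth N x ≤ growth (M + N) x := by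
  rw [growth, growth, growth, ← Real.exp_add]
  refine Real.exp_le_exp.2 ?_
  have h1 : ∑ j ∈ Finset.range M, ‖x j‖ ≤ ∑ j ∈ Finset.range (M + N), ‖x j‖ :=
    Finset.sum_le_sum_of_subset_of_nonneg (Finset.range_mono (by omega)) fun _ _ _ => norm_nonneg _
  have h2 : ∑ j ∈ Finset.range N, ‖x j‖ ≤ ∑ j ∈ Finset.range (M + N), ‖x j‖ :=
    Finset.sum_le_sum_of_subset_of_nonneg (Finset.range_mono (by omega)) fun _ _ _ => norm_nonneg _
  push_cast
  rw [add_mul]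
  gcongr

theorem one_le_growth (N : ℕ) (x : ℕ → E) : 1 ≤ growth N x :=
  Real.one_le_exp (mul_nonneg (Nat.cast_nonneg _)
    (add_nonneg zero_le_one (Finset.sum_nonneg fun _ _ => norm_nonneg _)))

theorem two_le_growth_one (x : ℕ → E) : 2 ≤ growth 1 x := by
  have h : (1 : ℝ) ≤ ((1 : ℕ) : ℝ) * (1 + ∑ j ∈ Finset.range 1, ‖x j‖) := by simp
  have := Real.add_one_le_exp (((1 : ℕ) : ℝ) * (1 + ∑ j ∈ Finset.range 1, ‖x j‖))
  rw [growth]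
  linarith

theorem exp_le_growth (c : ℝ) (j : ℕ) :
    ∃ N, ∀ x : ℕ → E, Real.exp (c * (1 + ‖x j‖)) ≤ growth N x := by
  -- `⌈c⌉₊` dominates the rate, and `j + 1` ensures that coordinate `j` is counted.
  refine ⟨max ⌈c⌉₊ (j + 1), fun x => Real.exp_le_exp.2 ?_⟩
  have h1 : c ≤ (max ⌈c⌉₊ (j + 1) : ℕ) := (Nat.le_ceil c).trans (by exact_mod_cast le_max_left _ _)
  have h2 : ‖x j‖ ≤ ∑ i ∈ Finset.range (max ⌈c⌉₊ (j + 1)), ‖x i‖ :=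
    Finset.single_le_sum (f := fun i => ‖x i‖) (fun _ _ => norm_nonneg _)
      (Finset.mem_range.2 (lt_of_lt_of_le (Nat.lt_succ_self j) (le_max_right _ _)))
  gcongr

variable [MeasurableSpace E]

/-- Measurable functions of finitely many variables that grow at most exponentially. -/
def HasExpGrowth (F : (ℕ → E) → ℂ) : Prop :=
  Measurable F ∧ ∃ N, ∀ x, ‖F x‖ ≤ growth N x

theorem HasExpGrowth.mul {F G : (ℕ → E) → ℂ} (hF : HasExpGrowth F) (hG : HasExpGrowth G) :
    HasExpGrowth fun x => F x * G x := by
  obtain ⟨hFm, M, hM⟩ := hF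
  obtain ⟨hGm, N, hN⟩ := hG
  refine ⟨hFm.mul hGm, M + N, fun x => ?_⟩
  rw [norm_mul]
  exact (mul_le_mul (hM x) (hN x) (norm_nonneg _) (zero_le_one.trans (one_le_growth M x))).trans
    (growth_mul_le M N x)

theorem HasExpGrowth.add {F G : (ℕ → E) → ℂ} (hF : HasExpGrowth F) (hG : HasExpGrowth G) :
    HasExpGrowth fun x => F x + G x := by
  obtain ⟨hFm, M, hM⟩ := hF
  obtain ⟨hGm, N, hN⟩ := hG
  refine ⟨hFm.add hGm, M + N + 1, fun x => ?_⟩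
  have h1 := one_le_growth M x
  have h2 := one_le_growth N x
  calc ‖F x + G x‖ ≤ growth M x + growth N x := (norm_add_le _ _).trans (add_le_add (hM x) (hN x))
    _ ≤ (growth M x * growth N x) * 2 := by nlinarith
    _ ≤ growth (M + N) x * growth 1 x := mul_le_mul (growth_mul_le M N x) (two_le_growth_one x)
        zero_le_two (zero_le_one.trans (one_le_growth _ x))
    _ ≤ growth (M + N + 1) x := growth_mul_le _ _ x

theorem HasExpGrowth.const (c : ℂ) : HasExpGrowth fun _ : ℕ → E => c := by
  obtain ⟨N, hN⟩ := exp_le_growth (E := E) ‖c‖ 0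
  refine ⟨measurable_const, N, fun x => le_trans ?_ (hN x)⟩
  have := Real.add_one_le_exp (‖c‖ * (1 + ‖x 0‖))
  nlinarith [norm_nonneg c, norm_nonneg (x 0)]

theorem HasExpGrowth.prod (S : Finset ℕ) {F : ℕ → (ℕ → E) → ℂ} (hF : ∀ j, HasExpGrowth (F j)) :
    HasExpGrowth fun x => ∏ j ∈ S, F j x := by
  classical
  induction S using Finset.induction_on with
  | empty => simpa using HasExpGrowth.const 1
  | insert j S hj ih =>
    simp only [Finset.prod_insert hj]
    exact (hF j).mul ih

theorem HasExpGrowth.of_norm_le {F : (ℕ → E) → ℂ} (hm : Measurable F) (c : ℝ) (j : ℕ)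
    (h : ∀ x, ‖F x‖ ≤ Real.exp (c * (1 + ‖x j‖))) : HasExpGrowth F := by
  obtain ⟨N, hN⟩ := exp_le_growth (E := E) c j
  exact ⟨hm, N, fun x => (h x).trans (hN x)⟩

variable {ν : Measure E} [IsProbabilityMeasure ν]

/-- The squared bound is a constant times a product of exponentials of independent coordinates, each
integrable. -/
theorem memLp_of_hasExpGrowth [BorelSpace E] (hν : ∀ R : ℝ, Integrable (fun x => Real.exp (R * ‖x‖)) ν)
    {F : (ℕ → E) → ℂ} (hF : HasExpGrowth F) : MemLp F 2 (Measure.infinitePi fun _ : ℕ => ν) := by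
  obtain ⟨hm, N, hN⟩ := hF
  rw [memLp_two_iff_integrable_sq_norm hm.aestronglyMeasurable]
  have h1 : Integrable (fun y : Fin N → E => ∏ j, Real.exp (2 * N * ‖y j‖))
      (Measure.pi fun _ => ν) := Integrable.fintype_prod fun _ => hν (2 * N)
  have h2 := ((measurePreserving_firstCoords ν N).integrable_comp_of_integrable h1).const_mul
    (Real.exp (2 * N))
  refine h2.mono' (hm.norm.pow_const 2).aestronglyMeasurable (Eventually.of_forall fun x => ?_)
  rw [Real.norm_of_nonneg (by positivity)]
  calc ‖F x‖ ^ 2 ≤ growth N x ^ 2 := by gcongr; exact hN x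
    _ = _ := by
      simp only [growth, Function.comp_apply, firstCoords]
      rw [← Real.exp_sum, ← Real.exp_add, ← Real.exp_nat_mul, ← Finset.mul_sum, Finset.sum_range]
      congr 1
      push_cast
      ring

end Growth

/-! ### Exponentials of finitely supported sequences and their Gaussian integrals -/

section Exponentials

/-- The exponential `x ↦ exp(∑ j, w_j φ(x_j))` of a finitely supported sequence `w`. -/
def expFun {E : Type} (φ : E → ℂ) (w : ℕ →₀ ℂ) (x : ℕ → E) : ℂ :=
  Complex.exp (w.sum fun j c => c * φ (x j))

/-- The freedom in `S` lets two sequences be expanded over a common index set. -/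
theorem expFun_eq_prod {E : Type} (φ : E → ℂ) (w : ℕ →₀ ℂ) {S : Finset ℕ} (hS : w.support ⊆ S)
    (x : ℕ → E) : expFun φ w x = ∏ j ∈ S, Complex.exp (w j * φ (x j)) := by
  rw [expFun, Finsupp.sum_of_support_subset w hS (fun j c => c * φ (x j))
    fun _ _ => zero_mul _, Complex.exp_sum]

variable {E : Type} [NormedAddCommGroup E] [MeasurableSpace E]

theorem hasExpGrowth_expFun {φ : E → ℂ} (hφm : Measurable φ) (hφ : ∀ x, ‖φ x‖ = ‖x‖) (w : ℕ →₀ ℂ) :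
    HasExpGrowth (expFun φ w) := by
  rw [show expFun φ w = _ from funext fun x => expFun_eq_prod φ w subset_rfl x]
  refine HasExpGrowth.prod _ fun j => HasExpGrowth.of_norm_le (by fun_prop) ‖w j‖ j
    fun x => ?_
  refine (Complex.norm_exp_le_exp_norm _).trans (Real.exp_le_exp.2 ?_)
  rw [norm_mul, hφ]
  nlinarith [norm_nonneg (w j), norm_nonneg (x j)]

theorem integral_prod_infinitePi {E : Type} [MeasurableSpace E] {ν : Measure E}
    [IsProbabilityMeasure ν] (S : Finset ℕ) {f : ℕ → E → ℂ} (hf : ∀ j, Measurable (f j)) :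
    ∫ x, ∏ j ∈ S, f j (x j) ∂(Measure.infinitePi fun _ : ℕ => ν) = ∏ j ∈ S, ∫ y, f j y ∂ν := by
  have h := integral_restrict_infinitePi (μ := fun _ : ℕ => ν) (s := S)
    (f := fun y : S → E => ∏ j : S, f j (y j))
    (Finset.measurable_fun_prod (f := fun (j : S) (y : S → E) => f j (y j)) _ fun j _ =>
      (hf j).comp (measurable_pi_apply j)).aestronglyMeasurable
  rw [integral_fintype_prod_eq_prod (fun j : S => f j), Finset.prod_coe_sort S
    fun j => ∫ y, f j y ∂ν] at h
  rw [← h]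
  refine integral_congr_ae (Eventually.of_forall fun x => ?_)
  exact (Finset.prod_coe_sort S fun j => f j (x j)).symm

end Exponentials

section OneVariable

theorem integrable_exp_mul_norm_gaussianReal (v : ℝ≥0) (R : ℝ) :
    Integrable (fun x => Real.exp (R * ‖x‖)) (gaussianReal 0 v) := by
  have h := integrable_exp_mul_abs (X := id) (t := R) (μ := gaussianReal 0 v)
    (integrable_exp_mul_gaussianReal R) (integrable_exp_mul_gaussianReal (-R))
  exact h

theorem integrable_exp_mul_norm_xiOne (s t R : ℝ) :
    Integrable (fun z => Real.exp (R * ‖z‖)) (xiOne s t) := by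
  rw [xiOne, integrable_map_equiv]
  refine ((integrable_exp_mul_norm_gaussianReal _ |R|).mul_prod
    (integrable_exp_mul_norm_gaussianReal _ |R|)).mono' ?_ (Eventually.of_forall fun p => ?_)
  · have : Measurable fun z : ℂ => Real.exp (R * ‖z‖) := by fun_prop
    exact (this.comp Complex.measurableEquivRealProd.symm.measurable).aestronglyMeasurable
  · rw [Real.norm_of_nonneg (by simp only [Function.comp_apply]; positivity), ← Real.exp_add]
    refine Real.exp_le_exp.2 ?_
    have h := Complex.norm_le_abs_re_add_abs_im (Complex.measurableEquivRealProd.symm p)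
    calc R * ‖Complex.measurableEquivRealProd.symm p‖
        ≤ |R| * ‖Complex.measurableEquivRealProd.symm p‖ :=
          mul_le_mul_of_nonneg_right (le_abs_self R) (norm_nonneg _)
      _ ≤ |R| * (|p.1| + |p.2|) := mul_le_mul_of_nonneg_left h (abs_nonneg R)
      _ = _ := by rw [mul_add]; rfl

theorem integral_cexp_mul_gaussianReal {v : ℝ} (hv : 0 ≤ v) (c : ℂ) :
    ∫ x : ℝ, Complex.exp (c * x) ∂(gaussianReal 0 v.toNNReal) = Complex.exp (v * c ^ 2 / 2) := by
  have := complexMGF_id_gaussianReal (μ := 0) (v := v.toNNReal) c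
  simpa [complexMGF, hv] using this

/-- The exponent is `(ā + b)u + i(b - ā)v`, with variances `(2s - t)/2` and `t/2`. Compared with
`μ_s`, the extra exponent is a function of `a` plus a function of `b`, so rescaling the exponentials
removes it. -/
theorem integral_exp_xiOne {s t : ℝ} (ht : 0 < t) (hts : t < 2 * s) (a b : ℂ) :
    ∫ z : ℂ, Complex.exp ((starRingEnd ℂ) (a * z) + b * z) ∂(xiOne s t)
      = Complex.exp (s * ((starRingEnd ℂ) a + b) ^ 2 / 2
          - t * ((starRingEnd ℂ) a ^ 2 + b ^ 2) / 2) := by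
  set a' := (starRingEnd ℂ) a with ha'
  rw [xiOne, integral_map_equiv]
  have h : ∀ p : ℝ × ℝ, Complex.exp ((starRingEnd ℂ) (a * Complex.measurableEquivRealProd.symm p)
      + b * Complex.measurableEquivRealProd.symm p)
      = Complex.exp ((a' + b) * p.1) * Complex.exp ((Complex.I * (b - a')) * p.2) := by
    intro p
    have hp : Complex.measurableEquivRealProd.symm p = p.1 + p.2 * Complex.I := by
      apply Complex.ext <;> simp
    rw [hp, ← Complex.exp_add]
    congr 1
    simp only [map_mul, map_add, Complex.conj_ofReal, Complex.conj_I]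
    rw [← ha']
    ring
  simp only [h]
  rw [integral_prod_mul (fun x : ℝ => Complex.exp ((a' + b) * x))
    (fun x : ℝ => Complex.exp ((Complex.I * (b - a')) * x)),
    integral_cexp_mul_gaussianReal (by linarith), integral_cexp_mul_gaussianReal (by linarith),
    ← Complex.exp_add]
  congr 1
  push_cast
  rw [mul_pow, Complex.I_sq]
  ring

theorem integral_exp_muOne {s : ℝ} (hs : 0 < s) (a b : ℂ) :
    ∫ x : ℝ, Complex.exp ((starRingEnd ℂ) (a * x) + b * x) ∂(muOne s)
      = Complex.exp (s * ((starRingEnd ℂ) a + b) ^ 2 / 2) := by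
  rw [← integral_cexp_mul_gaussianReal hs.le, muOne]
  congr 1
  ext x
  simp only [map_mul, Complex.conj_ofReal]
  rw [add_mul]

end OneVariable

/-! ### Totality of exponentials and the isometry in infinitely many variables -/

section InfiniteExponentials

theorem memLp_muInf {s : ℝ} {F : (ℕ → ℝ) → ℂ} (hF : HasExpGrowth F) : MemLp F 2 (muInf s) :=
  memLp_of_hasExpGrowth (ν := muOne s) (integrable_exp_mul_norm_gaussianReal _) hF

/-- The exponential of a finitely supported sequence in `L²(ℝ^∞, μ_s^∞)`. -/
def expMuInf (s : ℝ) (w : ℕ →₀ ℂ) : Lp ℂ 2 (muInf s) :=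
  (memLp_muInf (hasExpGrowth_expFun Complex.measurable_ofReal Complex.norm_real w)).toLp _

theorem memLp_xiInf {s t : ℝ} {F : (ℕ → ℂ) → ℂ} (hF : HasExpGrowth F) : MemLp F 2 (xiInf s t) :=
  memLp_of_hasExpGrowth (integrable_exp_mul_norm_xiOne s t) hF

theorem hasExpGrowth_exp (w : ℕ →₀ ℂ) : HasExpGrowth (expFun (id : ℂ → ℂ) w) :=
  hasExpGrowth_expFun measurable_id (fun _ => rfl) w

/-- The exponential of a finitely supported sequence in `L²(ℂ^∞, ξ_{s,t}^∞)`. -/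
def expXiInf (s t : ℝ) (w : ℕ →₀ ℂ) : Lp ℂ 2 (xiInf s t) := (memLp_xiInf (hasExpGrowth_exp w)).toLp _

theorem inner_toLp_expFun {E : Type} [MeasurableSpace E] {ν : Measure E} [IsProbabilityMeasure ν]
    {φ : E → ℂ} (hφ : Measurable φ) {w w' : ℕ →₀ ℂ}
    (hw : MemLp (expFun φ w) 2 (Measure.infinitePi fun _ : ℕ => ν))
    (hw' : MemLp (expFun φ w') 2 (Measure.infinitePi fun _ : ℕ => ν)) {S : Finset ℕ}
    (hS : w.support ⊆ S) (hS' : w'.support ⊆ S) :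
    ⟪hw.toLp _, hw'.toLp _⟫_ℂ
      = ∏ j ∈ S, ∫ x, Complex.exp ((starRingEnd ℂ) (w j * φ x) + w' j * φ x) ∂ν := by
  rw [← integral_prod_infinitePi S fun j => by fun_prop, L2.inner_def]
  refine integral_congr_ae ?_
  filter_upwards [hw.coeFn_toLp, hw'.coeFn_toLp] with x h1 h2
  rw [h1, h2, RCLike.inner_apply, expFun_eq_prod φ w hS, expFun_eq_prod φ w' hS', map_prod,
    ← Finset.prod_mul_distrib]
  refine Finset.prod_congr rfl fun j _ => ?_
  rw [Complex.exp_add, ← Complex.exp_conj, mul_comm]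

theorem cylinder_expMu {k : ℕ} {s : ℝ} (hs : 0 < s) (w : Fin k → ℂ) :
    cylinder (muOne s) k (expMu k hs w)
      = expMuInf s ((Finsupp.equivFunOnFinite.symm w).embDomain Fin.valEmbedding) := by
  refine Lp.ext ?_
  refine (coeFn_cylinder (muOne s) k _).trans ?_
  refine ((measurePreserving_firstCoords (muOne s) k).quasiMeasurePreserving.ae_eq_comp
    (coeFn_expMu k hs w)).trans ?_
  refine EventuallyEq.trans (Eventually.of_forall fun x => ?_) (MemLp.coeFn_toLp _).symm
  simp only [Function.comp_apply, gaussExp, expFun, firstCoords]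
  rw [Finsupp.sum_embDomain, Finsupp.sum_fintype _ _ fun _ => zero_mul _]
  simp

/-- Cylinder functions are dense, and each is a limit of exponentials in its finitely many
variables. -/
theorem closure_span_expMuInf {s : ℝ} (hs : 0 < s) :
    (Submodule.span ℂ (Set.range (expMuInf s))).topologicalClosure = ⊤ := by
  rw [eq_top_iff, ← closure_span_cylinder (muOne s)]
  refine Submodule.topologicalClosure_minimal _ (Submodule.span_le.2 ?_)
    (Submodule.isClosed_topologicalClosure _)
  rintro F ⟨k, -, f, rfl⟩
  have hf : f ∈ closure (Submodule.span ℂ (Set.range (expMu k hs)) : Set (Lp ℂ 2 (mu k s))) := by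
    have : f ∈ (⊤ : Submodule ℂ (Lp ℂ 2 (mu k s))) := Submodule.mem_top
    rwa [← closure_span_expMu k hs] at this
  refine map_mem_closure (cylinder (muOne s) k).continuous hf fun g hg => ?_
  have : Submodule.span ℂ (Set.range (expMu k hs)) ≤
      (Submodule.span ℂ (Set.range (expMuInf s))).comap (cylinder (muOne s) k).toLinearMap := by
    refine Submodule.span_le.2 ?_
    rintro _ ⟨w, rfl⟩
    exact Submodule.subset_span ⟨_, (cylinder_expMu hs w).symm⟩
  exact this hg

/-- The isometry that extends the Segal–Bargmann transforms in finitely many variables. -/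
theorem exists_isometry_exp {s t : ℝ} (ht : 0 < t) (hts : t < 2 * s) :
    ∃ V : Lp ℂ 2 (muInf s) →ₗᵢ[ℂ] Lp ℂ 2 (xiInf s t), ∀ w : ℕ →₀ ℂ,
      V (expMuInf s w) = Complex.exp (w.sum fun _ c => t * c ^ 2 / 2) • expXiInf s t w := by
  have hs : 0 < s := by linarith
  refine exists_linearIsometry_of_gram (expMuInf s) _ (fun w w' => ?_) (closure_span_expMuInf hs)
  classical
  have hS : w.support ⊆ w.support ∪ w'.support := Finset.subset_union_left
  have hS' : w'.support ⊆ w.support ∪ w'.support := Finset.subset_union_right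
  rw [inner_smul_left, inner_smul_right, expMuInf, expMuInf, expXiInf, expXiInf,
    inner_toLp_expFun Complex.measurable_ofReal _ _ hS hS',
    inner_toLp_expFun measurable_id _ _ hS hS',
    Finsupp.sum_of_support_subset w hS _ (fun _ _ => by simp),
    Finsupp.sum_of_support_subset w' hS' _ (fun _ _ => by simp), Complex.exp_sum, Complex.exp_sum,
    map_prod, ← Finset.prod_mul_distrib, ← Finset.prod_mul_distrib]
  refine Finset.prod_congr rfl fun j _ => ?_
  simp only [id]
  rw [integral_exp_muOne hs, integral_exp_xiOne ht hts, ← Complex.exp_conj, ← Complex.exp_add,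
    ← Complex.exp_add]
  congr 1
  simp only [map_div₀, map_mul, map_pow, Complex.conj_ofReal, map_ofNat]
  ring

end InfiniteExponentials

/-! ### Exponentials and polynomials have the same closed span -/

section Polynomials

variable (s t : ℝ)

theorem hasExpGrowth_apply (j : ℕ) : HasExpGrowth fun a : ℕ → ℂ => a j := by
  refine HasExpGrowth.of_norm_le (measurable_pi_apply j) 1 j fun a => ?_
  have := Real.add_one_le_exp (1 * (1 + ‖a j‖))
  linarith

theorem hasExpGrowth_eval (p : MvPolynomial ℕ ℂ) :
    HasExpGrowth fun a : ℕ → ℂ => MvPolynomial.eval a p := by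
  induction p using MvPolynomial.induction_on with
  | C c => simpa using HasExpGrowth.const c
  | add p q hp hq => simpa using hp.add hq
  | mul_X p j hp => simpa using hp.mul (hasExpGrowth_apply j)

theorem isClosed_HL2Inf : IsClosed (HL2Inf s t : Set (Lp ℂ 2 (xiInf s t))) :=
  Submodule.isClosed_topologicalClosure _

theorem toLp_eval_mem_holPoly (p : MvPolynomial ℕ ℂ) :
    (memLp_xiInf (s := s) (t := t) (hasExpGrowth_eval p)).toLp _ ∈ holPoly s t :=
  ⟨p, MemLp.coeFn_toLp _⟩

theorem hasExpGrowth_exp_norm (j : ℕ) (c : ℂ) :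
    HasExpGrowth fun a : ℕ → ℂ => ((Real.exp ‖c * a j‖ : ℝ) : ℂ) := by
  refine HasExpGrowth.of_norm_le (by fun_prop) ‖c‖ j fun a => ?_
  rw [Complex.norm_real, Real.norm_of_nonneg (Real.exp_pos _).le, norm_mul]
  refine Real.exp_le_exp.2 ?_
  nlinarith [norm_nonneg c, norm_nonneg (a j)]

/-- The exponentials are limits of holomorphic polynomials. -/
theorem expXiInf_mem_HL2Inf (w : ℕ →₀ ℂ) : expXiInf s t w ∈ HL2Inf s t := by
  let L : MvPolynomial ℕ ℂ := ∑ j ∈ w.support, MvPolynomial.C (w j) * MvPolynomial.X j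
  let p : ℕ → MvPolynomial ℕ ℂ := fun n =>
    ∑ i ∈ Finset.range n, MvPolynomial.C ((i.factorial : ℂ)⁻¹) * L ^ i
  have hL : ∀ a : ℕ → ℂ, MvPolynomial.eval a L = w.sum fun j c => c * id (a j) := fun a => by
    simp [L, Finsupp.sum]
  have hp : ∀ n (a : ℕ → ℂ), MvPolynomial.eval a (p n)
      = ∑ i ∈ Finset.range n, (w.sum fun j c => c * id (a j)) ^ i / i.factorial := fun n a => by
    simp only [p, map_sum, map_mul, map_pow, hL, MvPolynomial.eval_C]
    exact Finset.sum_congr rfl fun i _ => by rw [div_eq_inv_mul]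
  have hG : HasExpGrowth fun a : ℕ → ℂ =>
      ∏ j ∈ w.support, ((Real.exp ‖w j * a j‖ : ℝ) : ℂ) :=
    HasExpGrowth.prod _ fun j => hasExpGrowth_exp_norm j (w j)
  -- The Taylor sums `p n` are all dominated by `exp(∑ |w_j a_j|)`, which is square integrable.
  refine mem_of_dominated_convergence (HL2Inf s t) (isClosed_HL2Inf s t)
    (fun n => memLp_xiInf (hasExpGrowth_eval (p n))) (memLp_xiInf (hasExpGrowth_exp w))
    (memLp_xiInf hG).norm (fun n a => ?_) (fun a => ?_)
    (fun n => Submodule.le_topologicalClosure _ (toLp_eval_mem_holPoly s t (p n)))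
  · rw [hp, norm_prod]
    simp only [Complex.norm_real, Real.norm_of_nonneg (Real.exp_pos _).le]
    rw [← Real.exp_sum]
    refine (norm_sum_le _ _).trans ?_
    have h1 : ‖w.sum fun j c => c * id (a j)‖ ≤ ∑ j ∈ w.support, ‖w j * a j‖ := norm_sum_le _ _
    refine le_trans ?_ (Real.exp_le_exp.2 h1)
    simp only [norm_div, norm_pow, Complex.norm_natCast]
    exact Real.sum_le_exp_of_nonneg (norm_nonneg _) n
  · simp only [hp]
    have := (NormedSpace.expSeries_div_hasSum_exp (𝔸 := ℂ)
      (w.sum fun j c => c * id (a j))).tendsto_sum_nat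
    rwa [← Complex.exp_eq_exp_ℂ] at this

theorem tendsto_exp_sub_one_div (x : ℂ) :
    Tendsto (fun m : ℕ => (Complex.exp (1 / ((m : ℂ) + 1) * x) - 1) / (1 / ((m : ℂ) + 1))) atTop
      (𝓝 x) := by
  have h1 : HasDerivAt (fun h : ℂ => Complex.exp (h * x)) x 0 := by
    have := ((hasDerivAt_id (0 : ℂ)).mul_const x).cexp
    simpa using this
  rw [hasDerivAt_iff_tendsto_slope_zero] at h1
  have h2 : Tendsto (fun m : ℕ => 1 / ((m : ℂ) + 1)) atTop (𝓝[≠] 0) := by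
    refine tendsto_nhdsWithin_iff.2 ⟨tendsto_one_div_add_atTop_nhds_zero_nat,
      Eventually.of_forall fun m => ?_⟩
    exact one_div_ne_zero (Nat.cast_add_one_ne_zero m)
  refine (h1.comp h2).congr fun m => ?_
  simp only [Function.comp_apply, zero_add, zero_mul, Complex.exp_zero, smul_eq_mul]
  exact (div_eq_inv_mul _ _).symm

/-- The bound is uniform in `m` because the increment has modulus at most `1`; it serves as majorant
for the difference quotients. -/
theorem norm_exp_sub_one_div_le (m : ℕ) (x : ℂ) :
    ‖(Complex.exp (1 / ((m : ℂ) + 1) * x) - 1) / (1 / ((m : ℂ) + 1))‖ ≤ ‖x‖ * Real.exp ‖x‖ := by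
  set h : ℂ := 1 / ((m : ℂ) + 1) with hh
  have h0 : h ≠ 0 := one_div_ne_zero (Nat.cast_add_one_ne_zero m)
  have h1 : ‖h‖ ≤ 1 := by
    have e : h = ((1 / ((m : ℝ) + 1) : ℝ) : ℂ) := by rw [hh]; push_cast; rfl
    rw [e, Complex.norm_real, Real.norm_of_nonneg (by positivity), div_le_one (by positivity)]
    have := Nat.cast_nonneg (α := ℝ) m
    linarith
  have h2 := Complex.norm_exp_sub_sum_le_norm_mul_exp (h * x) 1
  simp only [Finset.sum_range_one, pow_zero, Nat.factorial_zero, Nat.cast_one, div_one, pow_one,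
    norm_mul] at h2
  rw [norm_div, div_le_iff₀ (norm_pos_iff.2 h0)]
  refine h2.trans ?_
  have h3 : Real.exp (‖h‖ * ‖x‖) ≤ Real.exp ‖x‖ :=
    Real.exp_le_exp.2 (mul_le_of_le_one_left (norm_nonneg _) h1)
  calc ‖h‖ * ‖x‖ * Real.exp (‖h‖ * ‖x‖) ≤ ‖h‖ * ‖x‖ * Real.exp ‖x‖ := by gcongr
    _ = _ := by ring

theorem hasExpGrowth_eval_mul_exp (p : MvPolynomial ℕ ℂ) (w : ℕ →₀ ℂ) :
    HasExpGrowth fun a => MvPolynomial.eval a p * expFun id w a :=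
  (hasExpGrowth_eval p).mul (hasExpGrowth_exp w)

theorem expFun_add_single (w : ℕ →₀ ℂ) (j : ℕ) (h : ℂ) (a : ℕ → ℂ) :
    expFun id (w + Finsupp.single j h) a = expFun id w a * Complex.exp (h * a j) := by
  rw [expFun, Finsupp.sum_add_index' (fun _ => zero_mul _) (fun _ _ _ => add_mul _ _ _),
    Finsupp.sum_single_index (zero_mul _), Complex.exp_add]
  rfl

/-- Products of polynomials and exponentials are limits of exponentials. -/
theorem eval_mul_exp_mem_closure (p : MvPolynomial ℕ ℂ) (w : ℕ →₀ ℂ) :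
    (memLp_xiInf (hasExpGrowth_eval_mul_exp p w)).toLp _
      ∈ (Submodule.span ℂ (Set.range (expXiInf s t))).topologicalClosure := by
  set K := (Submodule.span ℂ (Set.range (expXiInf s t))).topologicalClosure with hK
  -- A factor `a j` arises as the derivative of `exp(h a_j)` at `h = 0`. The difference quotient
  -- involves the shifted exponent `w + Finsupp.single j h`, hence the induction over all `w`.
  induction p using MvPolynomial.induction_on generalizing w with
  | C c =>
    have h : (memLp_xiInf (hasExpGrowth_eval_mul_exp (MvPolynomial.C c) w)).toLp _
        = c • expXiInf s t w := by
      rw [expXiInf, ← MemLp.toLp_const_smul]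
      refine MemLp.toLp_congr _ _ (Eventually.of_forall fun a => ?_)
      simp
    rw [h]
    exact K.smul_mem _ (Submodule.le_topologicalClosure _ (Submodule.subset_span ⟨w, rfl⟩))
  | add p q hp hq =>
    have h : (memLp_xiInf (s := s) (t := t) (hasExpGrowth_eval_mul_exp (p + q) w)).toLp _
        = (memLp_xiInf (hasExpGrowth_eval_mul_exp p w)).toLp _
          + (memLp_xiInf (hasExpGrowth_eval_mul_exp q w)).toLp _ := by
      rw [← MemLp.toLp_add]
      refine MemLp.toLp_congr _ _ (Eventually.of_forall fun a => ?_)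
      simp [add_mul]
    rw [h]
    exact K.add_mem (hp w) (hq w)
  | mul_X p j hp =>
    let h : ℕ → ℂ := fun m => 1 / ((m : ℂ) + 1)
    let F : ℕ → (ℕ → ℂ) → ℂ := fun m a => (h m)⁻¹ *
      (MvPolynomial.eval a p * expFun id (w + Finsupp.single j (h m)) a
        + -1 * (MvPolynomial.eval a p * expFun id w a))
    have hF : ∀ m, HasExpGrowth (F m) := fun m => (HasExpGrowth.const _).mul
      ((hasExpGrowth_eval_mul_exp p _).add
        ((HasExpGrowth.const _).mul (hasExpGrowth_eval_mul_exp p w)))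
    have hF' : ∀ m a, F m a = MvPolynomial.eval a p * expFun id w a *
        ((Complex.exp (h m * a j) - 1) / h m) := fun m a => by
      simp only [F, expFun_add_single]
      ring
    have hG : HasExpGrowth fun a : ℕ → ℂ => MvPolynomial.eval a p * expFun id w a *
        (a j * ((Real.exp ‖1 * a j‖ : ℝ) : ℂ)) :=
      (hasExpGrowth_eval_mul_exp p w).mul ((hasExpGrowth_apply j).mul (hasExpGrowth_exp_norm j 1))
    refine mem_of_dominated_convergence K (Submodule.isClosed_topologicalClosure _)
      (fun m => memLp_xiInf (hF m)) _ (memLp_xiInf hG).norm (fun m a => ?_) (fun a => ?_)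
      (fun m => ?_)
    · rw [hF', norm_mul, norm_mul _ (a j * _), norm_mul (a j), Complex.norm_real,
        Real.norm_of_nonneg (Real.exp_pos _).le, one_mul]
      exact mul_le_mul_of_nonneg_left (norm_exp_sub_one_div_le m (a j)) (norm_nonneg _)
    · simp only [hF', map_mul, MvPolynomial.eval_X]
      have := (tendsto_exp_sub_one_div (a j)).const_mul
        (MvPolynomial.eval a p * expFun id w a)
      rwa [mul_right_comm] at this
    · have e : (memLp_xiInf (s := s) (t := t) (hF m)).toLp _ = (h m)⁻¹ •
          ((memLp_xiInf (hasExpGrowth_eval_mul_exp p (w + Finsupp.single j (h m)))).toLp _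
            + (-1 : ℂ) • (memLp_xiInf (hasExpGrowth_eval_mul_exp p w)).toLp _) := by
        rw [← MemLp.toLp_const_smul, ← MemLp.toLp_add, ← MemLp.toLp_const_smul]
        rfl
      rw [e]
      exact K.smul_mem _ (K.add_mem (hp _) (K.smul_mem _ (hp _)))

theorem holPoly_le_closure_span_expXiInf :
    holPoly s t ≤ (Submodule.span ℂ (Set.range (expXiInf s t))).topologicalClosure := by
  rintro F ⟨p, hp⟩
  have h : F = (memLp_xiInf (hasExpGrowth_eval_mul_exp p 0)).toLp _ := by
    refine Lp.ext (hp.trans (EventuallyEq.trans (Eventually.of_forall fun a => ?_)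
      (MemLp.coeFn_toLp _).symm))
    simp [expFun]
  rw [h]
  exact eval_mul_exp_mem_closure s t p 0

end Polynomials

/-! ### Range of the isometry and its integral formula -/

section Unitary

variable {s t : ℝ}

/-- An isometric image of a complete space is closed, so both inclusions need checking only on
exponentials. -/
theorem range_eq_HL2Inf {V : Lp ℂ 2 (muInf s) →ₗᵢ[ℂ] Lp ℂ 2 (xiInf s t)} (hs : 0 < s)
    (hV : ∀ w : ℕ →₀ ℂ,
      V (expMuInf s w) = Complex.exp (w.sum fun _ c => t * c ^ 2 / 2) • expXiInf s t w) :
    LinearMap.range V.toLinearMap = HL2Inf s t := by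
  have hclosed : IsClosed (LinearMap.range V.toLinearMap : Set (Lp ℂ 2 (xiInf s t))) := by
    rw [LinearMap.coe_range]
    exact V.isometry.isClosedEmbedding.isClosed_range
  refine le_antisymm ?_ ?_
  · rintro _ ⟨x, rfl⟩
    have hx : x ∈ closure (Submodule.span ℂ (Set.range (expMuInf s)) : Set (Lp ℂ 2 (muInf s))) := by
      have : x ∈ (⊤ : Submodule ℂ (Lp ℂ 2 (muInf s))) := Submodule.mem_top
      rwa [← closure_span_expMuInf hs] at this
    rw [← SetLike.mem_coe, ← (isClosed_HL2Inf s t).closure_eq]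
    refine map_mem_closure V.continuous hx fun y hy => ?_
    have : Submodule.span ℂ (Set.range (expMuInf s)) ≤ (HL2Inf s t).comap V.toLinearMap := by
      refine Submodule.span_le.2 ?_
      rintro _ ⟨w, rfl⟩
      change V (expMuInf s w) ∈ HL2Inf s t
      rw [hV]
      exact Submodule.smul_mem _ _ (expXiInf_mem_HL2Inf s t w)
    exact this hy
  · refine Submodule.topologicalClosure_minimal _ ((holPoly_le_closure_span_expXiInf s t).trans
      (Submodule.topologicalClosure_minimal _ (Submodule.span_le.2 ?_) hclosed)) hclosed
    rintro _ ⟨w, rfl⟩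
    refine ⟨(Complex.exp (w.sum fun _ c => t * c ^ 2 / 2))⁻¹ • expMuInf s w, ?_⟩
    change V _ = _
    rw [map_smul, hV, smul_smul, inv_mul_cancel₀ (Complex.exp_ne_zero _), one_smul]

/-- Both sides agree on exponentials; the left is a bounded operator in `f` and the right a bounded
functional of `f` at each point, so agreement passes to the closed span. -/
theorem ae_eq_transform {V : Lp ℂ 2 (muInf s) →ₗᵢ[ℂ] Lp ℂ 2 (xiInf s t)} (ht : 0 < t)
    (hts : t < 2 * s)
    (hV : ∀ w : ℕ →₀ ℂ,
      V (expMuInf s w) = Complex.exp (w.sum fun _ c => t * c ^ 2 / 2) • expXiInf s t w)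
    (k : ℕ) (f : Lp ℂ 2 (mu k s)) :
    V (cylinder (muOne s) k f) =ᵐ[xiInf s t] fun a => transform k t f (firstCoords k a) := by
  have hs : 0 < s := by linarith
  obtain ⟨ℓ, hℓ⟩ := exists_transform_functional k ht hts
  simp only [hℓ]
  refine ae_eq_of_mem_closure_span
    (V.toContinuousLinearMap.comp (cylinder (muOne s) k).toContinuousLinearMap)
    (fun a => ℓ (firstCoords k a)) (A := Set.range (expMu k hs)) ?_
    (by rw [closure_span_expMu k hs]; exact Submodule.mem_top)
  rintro _ ⟨w, rfl⟩
  simp only [← hℓ]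
  rw [transform_congr_ae k hs (coeFn_expMu k hs w)]
  change V (cylinder (muOne s) k (expMu k hs w)) =ᵐ[xiInf s t] _
  rw [cylinder_expMu hs, hV]
  refine (Lp.coeFn_smul _ _).trans ?_
  filter_upwards [(memLp_xiInf (s := s) (t := t) (hasExpGrowth_exp
    ((Finsupp.equivFunOnFinite.symm w).embDomain Fin.valEmbedding))).coeFn_toLp] with a ha
  have h := transform_gaussExp k ht (c := 0) (by simp) w (firstCoords k a)
  rw [Complex.ofReal_zero] at h
  rw [Pi.smul_apply, expXiInf, ha, h, expFun, Finsupp.sum_embDomain, Finsupp.sum_embDomain,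
    Finsupp.sum_fintype _ _ (fun _ => by simp), Finsupp.sum_fintype _ _ (fun _ => by simp), gaussExp]
  simp [firstCoords]

end Unitary

/-! ### Entire square integrable functions are limits of polynomials -/

section HolomorphicDensity

variable {s t : ℝ}

/-- The reproducing exponentials are transforms of Gaussian exponentials. -/
theorem xiKernel_comp_firstCoords {V : Lp ℂ 2 (muInf s) →ₗᵢ[ℂ] Lp ℂ 2 (xiInf s t)} (ht : 0 < t)
    (hts : t < 2 * s)
    (hV : ∀ w : ℕ →₀ ℂ,
      V (expMuInf s w) = Complex.exp (w.sum fun _ c => t * c ^ 2 / 2) • expXiInf s t w)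
    (k : ℕ) (w : Fin k → ℂ) :
    ∃ F : Lp ℂ 2 (muInf s), V F =ᵐ[xiInf s t] fun a => xiKernel k s t w (firstCoords k a) := by
  have hs : 0 < s := by linarith
  have h2 : 0 < 2 * s - t := by linarith
  -- This is `1/(2s) - 1/(2t)`, and `W j` below equals `conj(w_j)/t`: up to a constant, the Gaussian
  -- is the vector of `L²(μ_s^k)` that represents the value of the transform at `w`.
  let c : ℝ := (t - s) / (2 * t * s)
  have hq : 1 - 2 * c * t = (2 * s - t) / s := by
    simp only [c]; field_simp; ring
  have hq0 : 0 < 1 - 2 * c * t := by rw [hq]; positivity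
  have hqc : (1 - 2 * c * t : ℂ) ≠ 0 := by exact_mod_cast hq0.ne'
  have hc4 : 4 * c * s < 1 := by
    have : 4 * c * s = 2 * (t - s) / t := by simp only [c]; field_simp; ring
    rw [this, div_lt_one ht]
    linarith
  have hcc : c / (1 - 2 * c * t) = (1 / (2 * s - t) - 1 / t) / 4 := by
    have h2n : 2 * s - t ≠ 0 := h2.ne'
    rw [hq, div_eq_iff (by positivity)]
    simp only [c]
    generalize hu : 2 * s - t = u at h2n
    have hs' : t = 2 * s - u := by linarith
    field_simp
    linear_combination (2 : ℝ) * hs'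
  let W : Fin k → ℂ := fun j => (1 - 2 * c * t) *
    (((1 / (2 * s - t) + 1 / t) / 2 : ℝ) * (starRingEnd ℂ) (w j))
  have hmem := memLp_gaussExp_mu (k := k) hs hc4 W
  let C : ℂ := (((√(1 - 2 * c * t))⁻¹ ^ k : ℝ) : ℂ) *
    Complex.exp (∑ j, t * W j ^ 2 / 2 / (1 - 2 * c * t))
  have hC : C ≠ 0 := by
    refine mul_ne_zero ?_ (Complex.exp_ne_zero _)
    exact_mod_cast (pow_pos (inv_pos.2 (Real.sqrt_pos.2 hq0)) k).ne'
  refine ⟨C⁻¹ • cylinder (muOne s) k (hmem.toLp _), ?_⟩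
  rw [map_smul]
  filter_upwards [Lp.coeFn_smul C⁻¹ (V (cylinder (muOne s) k (hmem.toLp _))),
    ae_eq_transform ht hts hV k (hmem.toLp _)] with a h3 h4
  rw [h3, Pi.smul_apply, h4, transform_congr_ae k hs hmem.coeFn_toLp,
    transform_gaussExp k ht (by linarith) W, smul_eq_mul]
  change C⁻¹ * (C * _) = _
  rw [inv_mul_cancel_left₀ hC, xiKernel, ← hcc]
  have hW : (fun j => W j / (1 - 2 * c * t : ℂ))
      = fun j => (((1 / (2 * s - t) + 1 / t) / 2 : ℝ) : ℂ) * (starRingEnd ℂ) (w j) := by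
    ext j
    simp only [W]
    rw [mul_div_cancel_left₀ _ hqc]
  rw [hW]
  push_cast
  rfl

/-- The entire functions in `L²(ℂ^k, ξ_{s,t}^k)` are limits of holomorphic polynomials. -/
theorem cylinder_mem_HL2Inf (ht : 0 < t) (hts : t < 2 * s) (k : ℕ) {g : (Fin k → ℂ) → ℂ}
    (hg : g ∈ HL2 k s t) : cylinder (xiOne s t) k (hg.2.toLp g) ∈ HL2Inf s t := by
  obtain ⟨V, hV⟩ := exists_isometry_exp ht hts
  have hmp := measurePreserving_firstCoords (xiOne s t) k
  have hcont : ∀ w, Continuous (xiKernel k s t w) := fun w => continuous_gaussExp _ _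
  -- Square integrability comes for free, since the kernel is a value of `V`.
  have hmem : ∀ w, MemLp (xiKernel k s t w) 2 (xi k s t) := by
    intro w
    obtain ⟨F, hF⟩ := xiKernel_comp_firstCoords ht hts hV k w
    have := (memLp_congr_ae hF).1 (Lp.memLp (V F))
    rw [xi, ← hmp.map_eq]
    exact (memLp_map_measure_iff (hcont w).aestronglyMeasurable hmp.measurable.aemeasurable).2 this
  let κ : (Fin k → ℂ) → Lp ℂ 2 (xi k s t) := fun w => (hmem w).toLp _
  have hκ : ∀ w, cylinder (xiOne s t) k (κ w) ∈ HL2Inf s t := by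
    intro w
    obtain ⟨F, hF⟩ := xiKernel_comp_firstCoords ht hts hV k w
    rw [← range_eq_HL2Inf (by linarith) hV]
    refine ⟨F, Lp.ext (hF.trans ?_)⟩
    exact ((coeFn_cylinder _ k _).trans
      (hmp.quasiMeasurePreserving.ae_eq_comp (hmem w).coeFn_toLp)).symm
  obtain ⟨A, hA⟩ := exists_reproducing k ht hts hmem
  have hinner : ∀ (w : Fin k → ℂ) {f : (Fin k → ℂ) → ℂ} (hf : MemLp f 2 (xi k s t)),
      ∫ z, (starRingEnd ℂ) (xiKernel k s t w z) * f z ∂(xi k s t) = ⟪κ w, hf.toLp f⟫_ℂ := by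
    intro w f hf
    rw [L2.inner_def]
    refine integral_congr_ae ?_
    filter_upwards [(hmem w).coeFn_toLp, hf.coeFn_toLp] with z h1 h2
    rw [h1, h2, RCLike.inner_apply, mul_comm]
  set K := (Submodule.span ℂ (Set.range κ)).topologicalClosure with hK
  have : CompleteSpace K := (Submodule.isClosed_topologicalClosure _).completeSpace_coe
  -- The reproducing formula holds for the kernels, hence almost everywhere for the projection `P`.
  -- As `Q` is orthogonal to every kernel, `P` and `g` have the same values.
  obtain ⟨P, hP, Q, hQ, hPQ⟩ := K.exists_add_mem_mem_orthogonal (hg.2.toLp g)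
  have hPae : P =ᵐ[xi k s t] fun z => A z * ⟪κ z, P⟫_ℂ := by
    refine ae_eq_of_mem_closure_span (ContinuousLinearMap.id ℂ (Lp ℂ 2 (xi k s t)))
      (fun z => A z • innerSL ℂ (κ z)) (A := Set.range κ) ?_ hP
    rintro _ ⟨w, rfl⟩
    refine (hmem w).coeFn_toLp.trans (Eventually.of_forall fun z => ?_)
    have := hA (xiKernel k s t w) ⟨differentiable_gaussExp _ _, hmem w⟩ z
    rw [hinner z (hmem w)] at this
    exact this
  have hgP : hg.2.toLp g = P := by
    refine Lp.ext (hg.2.coeFn_toLp.trans (EventuallyEq.trans (Eventually.of_forall fun z => ?_)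
      hPae.symm))
    have h0 : ⟪κ z, Q⟫_ℂ = 0 := (Submodule.mem_orthogonal _ _).1 hQ _
      (Submodule.le_topologicalClosure _ (Submodule.subset_span ⟨z, rfl⟩))
    rw [hA g hg z, hinner z hg.2, hPQ, inner_add_right, h0, add_zero]
  rw [hgP, ← SetLike.mem_coe, ← (isClosed_HL2Inf s t).closure_eq]
  have hP' : P ∈ closure (Submodule.span ℂ (Set.range κ) : Set (Lp ℂ 2 (xi k s t))) := hP
  refine map_mem_closure (cylinder (xiOne s t) k).continuous hP' fun y hy => ?_
  have : Submodule.span ℂ (Set.range κ)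
      ≤ (HL2Inf s t).comap (cylinder (xiOne s t) k).toLinearMap := by
    refine Submodule.span_le.2 ?_
    rintro _ ⟨w, rfl⟩
    exact hκ w
  exact this hy

/-- A polynomial is the cylinder function of an element of some `HL²(ℂ^k, ξ_{s,t}^k)`. -/
theorem exists_HL2_of_mem_holPoly {F : Lp ℂ 2 (xiInf s t)} (hF : F ∈ holPoly s t) :
    ∃ k : ℕ, 0 < k ∧ ∃ (g : (Fin k → ℂ) → ℂ) (hg : g ∈ HL2 k s t),
      cylinder (xiOne s t) k (hg.2.toLp g) = F := by
  obtain ⟨p, hp⟩ := hF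
  let k := p.vars.sup id + 1
  have hk : ∀ i ∈ p.vars, i < k := fun i hi => Nat.lt_succ_of_le (Finset.le_sup (f := id) hi)
  -- The default value `0` is harmless: no variable with index at least `k` occurs in `p`.
  let ext : (Fin k → ℂ) → ℕ → ℂ := fun b i => if h : i < k then b ⟨i, h⟩ else 0
  let g : (Fin k → ℂ) → ℂ := fun b => MvPolynomial.eval (ext b) p
  have hext : ∀ i, Differentiable ℂ fun b => ext b i := by
    intro i
    by_cases h : i < k
    · simp only [ext, h, dite_true]
      fun_prop
    · simp only [ext, h, dite_false]
      fun_prop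
  have hgd : ∀ q : MvPolynomial ℕ ℂ, Differentiable ℂ fun b => MvPolynomial.eval (ext b) q := by
    intro q
    induction q using MvPolynomial.induction_on with
    | C c => simp
    | add q r hq hr => simp only [map_add]; exact hq.add hr
    | mul_X q j hq => simp only [map_mul, MvPolynomial.eval_X]; exact hq.mul (hext j)
  have hcomp : ∀ a, g (firstCoords k a) = MvPolynomial.eval a p := by
    intro a
    refine MvPolynomial.eval₂Hom_congr' rfl (fun i hi _ => ?_) rfl
    simp [ext, hk i hi, firstCoords]
  have hmp := measurePreserving_firstCoords (xiOne s t) k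
  have hg : g ∈ HL2 k s t := by
    refine ⟨hgd p, ?_⟩
    rw [xi, ← hmp.map_eq]
    refine (memLp_map_measure_iff (hgd p).continuous.aestronglyMeasurable
      hmp.measurable.aemeasurable).2 ?_
    rw [show g ∘ firstCoords k = fun a => MvPolynomial.eval a p from funext hcomp]
    exact memLp_xiInf (hasExpGrowth_eval p)
  refine ⟨k, Nat.succ_pos _, g, hg, Lp.ext (EventuallyEq.trans ?_ hp.symm)⟩
  refine ((coeFn_cylinder _ k _).trans
    (hmp.quasiMeasurePreserving.ae_eq_comp hg.2.coeFn_toLp)).trans (Eventually.of_forall hcomp)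

end HolomorphicDensity

/-! ### The dilation as a measure preserving change of variables -/

section Dilation

variable {s t : ℝ}

/-- Scaling by `e^λ` multiplies variances by `e^{2λ}`; as the factor is real, it acts separately on
real and imaginary parts. -/
theorem map_dilation_xiOne (ht : 0 < t) (hts : t < 2 * s) (lam : ℝ) :
    (xiOne (s * Real.exp (-2 * lam)) (t * Real.exp (-2 * lam))).map (fun z => Complex.exp lam * z)
      = xiOne s t := by
  have hg : ∀ v : ℝ, 0 < v →
      (gaussianReal 0 (v * Real.exp (-2 * lam)).toNNReal).map (fun x => Real.exp lam * x)
        = gaussianReal 0 v.toNNReal := by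
    intro v hv
    rw [gaussianReal_map_const_mul, mul_zero]
    congr 1
    ext
    rw [NNReal.coe_mul, NNReal.coe_mk, Real.coe_toNNReal _ (by positivity),
      Real.coe_toNNReal _ hv.le, ← Real.exp_nat_mul, mul_left_comm, ← Real.exp_add]
    simp
  have e1 : (2 * (s * Real.exp (-2 * lam)) - t * Real.exp (-2 * lam)) / 2
      = (2 * s - t) / 2 * Real.exp (-2 * lam) := by ring
  have e2 : t * Real.exp (-2 * lam) / 2 = t / 2 * Real.exp (-2 * lam) := by ring
  rw [xiOne, xiOne, e1, e2, ← hg ((2 * s - t) / 2) (by linarith), ← hg (t / 2) (by linarith),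
    Measure.map_prod_map _ _ (by fun_prop) (by fun_prop),
    Measure.map_map (by fun_prop) (by fun_prop), Measure.map_map (by fun_prop) (by fun_prop)]
  congr 1
  ext p
  simp only [Function.comp_apply, Prod.map]
  apply Complex.ext <;> simp [Complex.exp_ofReal_re]

theorem measurePreserving_dilation (ht : 0 < t) (hts : t < 2 * s) (lam : ℝ) :
    MeasurePreserving (fun (a : ℕ → ℂ) i => Complex.exp lam * a i)
      (xiInf (s * Real.exp (-2 * lam)) (t * Real.exp (-2 * lam))) (xiInf s t) := by
  refine ⟨by fun_prop, ?_⟩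
  rw [Measure.infinitePi_map_pi _ fun _ => by fun_prop]
  simp only [map_dilation_xiOne ht hts]

theorem exists_eval_dilation (c : ℂ) (p : MvPolynomial ℕ ℂ) :
    ∃ q : MvPolynomial ℕ ℂ, ∀ a : ℕ → ℂ,
      MvPolynomial.eval a q = MvPolynomial.eval (fun i => c * a i) p := by
  refine ⟨MvPolynomial.bind₁ (fun i => MvPolynomial.C c * MvPolynomial.X i) p, fun a => ?_⟩
  induction p using MvPolynomial.induction_on with
  | C c => simp
  | add p q hp hq => simp [hp, hq]
  | mul_X p j hp => simp [hp]

/-- The unitary dilation. -/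
theorem exists_dilation (ht : 0 < t) (hts : t < 2 * s) (lam : ℝ) :
    ∃ D : HL2Inf s t ≃ₗᵢ[ℂ] HL2Inf (s * Real.exp (-2 * lam)) (t * Real.exp (-2 * lam)),
      ∀ F : HL2Inf s t, (D F : Lp ℂ 2 (xiInf (s * Real.exp (-2 * lam)) (t * Real.exp (-2 * lam))))
        =ᵐ[xiInf (s * Real.exp (-2 * lam)) (t * Real.exp (-2 * lam))]
          fun a => (F : Lp ℂ 2 (xiInf s t)) fun i => Complex.exp lam * a i := by
  have hδ := measurePreserving_dilation ht hts lam
  let U := Lp.compMeasurePreservingₗᵢ (E := ℂ) (p := 2) ℂ _ hδ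
  have hU : ∀ F, U F =ᵐ[_] fun a => F fun i => Complex.exp lam * a i := fun F =>
    Lp.coeFn_compMeasurePreserving F hδ
  let V := U.comp (HL2Inf s t).subtypeₗᵢ
  have : CompleteSpace (HL2Inf s t) := (isClosed_HL2Inf s t).completeSpace_coe
  have hclosed : IsClosed (LinearMap.range V.toLinearMap :
      Set (Lp ℂ 2 (xiInf (s * Real.exp (-2 * lam)) (t * Real.exp (-2 * lam))))) := by
    rw [LinearMap.coe_range]
    exact V.isometry.isClosedEmbedding.isClosed_range
  have hrange : LinearMap.range V.toLinearMap
      = HL2Inf (s * Real.exp (-2 * lam)) (t * Real.exp (-2 * lam)) := by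
    refine le_antisymm ?_ (Submodule.topologicalClosure_minimal _ ?_ hclosed)
    · rintro _ ⟨⟨F, hF⟩, rfl⟩
      refine map_mem_closure U.continuous (t := (holPoly (s * Real.exp (-2 * lam))
        (t * Real.exp (-2 * lam)) : Set (Lp ℂ 2 _))) hF ?_
      rintro G ⟨p, hp⟩
      obtain ⟨q, hq⟩ := exists_eval_dilation (Complex.exp lam) p
      refine ⟨q, (hU G).trans ((hδ.quasiMeasurePreserving.ae_eq_comp hp).trans
        (Eventually.of_forall fun a => (hq a).symm))⟩
    -- Surjectivity: the inverse substitution, with `e^{-λ}`, gives a polynomial preimage of `p`.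
    · rintro G ⟨p, hp⟩
      obtain ⟨q, hq⟩ := exists_eval_dilation (Complex.exp (-lam)) p
      refine ⟨⟨_, Submodule.le_topologicalClosure _ (toLp_eval_mem_holPoly s t q)⟩, Lp.ext ?_⟩
      refine (hU _).trans ((hδ.quasiMeasurePreserving.ae_eq_comp
        (memLp_xiInf (hasExpGrowth_eval q)).coeFn_toLp).trans
        (EventuallyEq.trans (Eventually.of_forall fun a => ?_) hp.symm))
      simp only [Function.comp_apply]
      rw [hq]
      simp only [← mul_assoc, ← Complex.exp_add, neg_add_cancel, Complex.exp_zero, one_mul]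
  rw [← hrange]
  exact ⟨V.equivRange, fun F => hU F⟩

end Dilation

end SegalBargmann

end

/-! ### Existence and uniqueness of the two unitary maps -/

theorem mainTheorem4 (s t : ℝ) (ht : 0 < t) (hts : t < 2 * s) :
    (∃! B : Lp ℂ 2 (SegalBargmann.muInf s) ≃ₗᵢ[ℂ] SegalBargmann.HL2Inf s t,
      ∀ k : ℕ, 0 < k → ∀ f : Lp ℂ 2 (SegalBargmann.mu k s),
        ((B (SegalBargmann.cylinder (SegalBargmann.muOne s) k f) :
            Lp ℂ 2 (SegalBargmann.xiInf s t)) : (ℕ → ℂ) → ℂ)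
          =ᵐ[SegalBargmann.xiInf s t]
            fun a => SegalBargmann.transform k t f (SegalBargmann.firstCoords k a)) ∧
    ∀ lam : ℝ,
      ∃! D : SegalBargmann.HL2Inf s t ≃ₗᵢ[ℂ]
          SegalBargmann.HL2Inf (s * Real.exp (-2 * lam)) (t * Real.exp (-2 * lam)),
        ∀ k : ℕ, 0 < k → ∀ (g : (Fin k → ℂ) → ℂ) (hg : g ∈ SegalBargmann.HL2 k s t),
          ∃ hG : SegalBargmann.cylinder (SegalBargmann.xiOne s t) k (hg.2.toLp g)
              ∈ SegalBargmann.HL2Inf s t,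
            ((D ⟨_, hG⟩ :
                Lp ℂ 2 (SegalBargmann.xiInf (s * Real.exp (-2 * lam)) (t * Real.exp (-2 * lam)))) :
                (ℕ → ℂ) → ℂ)
              =ᵐ[SegalBargmann.xiInf (s * Real.exp (-2 * lam)) (t * Real.exp (-2 * lam))]
                fun a => SegalBargmann.dilation k lam g (SegalBargmann.firstCoords k a) := by
  have hs : 0 < s := by linarith
  refine ⟨?_, fun lam => ?_⟩
  · obtain ⟨V, hV⟩ := SegalBargmann.exists_isometry_exp ht hts
    obtain ⟨B, hB⟩ : ∃ B : Lp ℂ 2 (SegalBargmann.muInf s) ≃ₗᵢ[ℂ] SegalBargmann.HL2Inf s t,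
        ∀ F, (B F : Lp ℂ 2 (SegalBargmann.xiInf s t)) = V F := by
      rw [← SegalBargmann.range_eq_HL2Inf hs hV]
      exact ⟨V.equivRange, fun _ => rfl⟩
    refine ⟨B, fun k _ f => ?_, fun B' hB' => ?_⟩
    · rw [hB]
      exact SegalBargmann.ae_eq_transform ht hts hV k f
    · have hcl : B'.toLinearIsometry.toContinuousLinearMap
          = B.toLinearIsometry.toContinuousLinearMap := by
        refine ContinuousLinearMap.ext_on (Submodule.dense_iff_topologicalClosure_eq_top.2
          (SegalBargmann.closure_span_cylinder (SegalBargmann.muOne s))) ?_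
        rintro _ ⟨k, hk, f, rfl⟩
        refine Subtype.ext (Lp.ext ((hB' k hk f).trans ?_))
        refine (SegalBargmann.ae_eq_transform ht hts hV k f).symm.trans ?_
        rw [← hB]
        exact Filter.EventuallyEq.rfl
      exact LinearIsometryEquiv.ext fun F => DFunLike.congr_fun hcl F
  · obtain ⟨D, hD⟩ := SegalBargmann.exists_dilation ht hts lam
    have hδ := SegalBargmann.measurePreserving_dilation ht hts lam
    have hDk : ∀ (k : ℕ) (g : (Fin k → ℂ) → ℂ) (hg : g ∈ SegalBargmann.HL2 k s t),
        ∃ hG : SegalBargmann.cylinder (SegalBargmann.xiOne s t) k (hg.2.toLp g)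
            ∈ SegalBargmann.HL2Inf s t,
          ((D ⟨_, hG⟩ :
              Lp ℂ 2 (SegalBargmann.xiInf (s * Real.exp (-2 * lam)) (t * Real.exp (-2 * lam)))) :
              (ℕ → ℂ) → ℂ)
            =ᵐ[SegalBargmann.xiInf (s * Real.exp (-2 * lam)) (t * Real.exp (-2 * lam))]
              fun a => SegalBargmann.dilation k lam g (SegalBargmann.firstCoords k a) := by
      intro k g hg
      refine ⟨SegalBargmann.cylinder_mem_HL2Inf ht hts k hg, (hD _).trans ?_⟩
      exact hδ.quasiMeasurePreserving.ae_eq_comp ((SegalBargmann.coeFn_cylinder _ k _).trans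
        ((SegalBargmann.measurePreserving_firstCoords (SegalBargmann.xiOne s t)
          k).quasiMeasurePreserving.ae_eq_comp hg.2.coeFn_toLp))
    refine ⟨D, fun k _ g hg => hDk k g hg, fun D' hD' => LinearIsometryEquiv.ext fun F => ?_⟩
    -- Uniqueness: each polynomial is a cylinder function of some entire square integrable function,
    -- where `D'` and `D` are prescribed; continuity extends the equality to the limit `F`.
    obtain ⟨u, hu, hlim⟩ := mem_closure_iff_seq_limit.1 F.2
    let x : ℕ → SegalBargmann.HL2Inf s t := fun n =>
      ⟨u n, Submodule.le_topologicalClosure _ (hu n)⟩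
    have hx : Filter.Tendsto x Filter.atTop (nhds F) := tendsto_subtype_rng.2 hlim
    have hDx : ∀ n, D' (x n) = D (x n) := by
      intro n
      obtain ⟨k, hk, g, hg, hgF⟩ := SegalBargmann.exists_HL2_of_mem_holPoly (hu n)
      obtain ⟨hG, h1⟩ := hD' k hk g hg
      obtain ⟨_, h2⟩ := hDk k g hg
      have hxn : x n = ⟨_, hG⟩ := Subtype.ext hgF.symm
      rw [hxn]
      exact Subtype.ext (Lp.ext (h1.trans h2.symm))
    refine tendsto_nhds_unique ((D'.continuous.tendsto F).comp hx) ?_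
    simp only [Function.comp_def, hDx]
    exact (D.continuous.tendsto F).comp hx
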